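/- Let $S(\infty)=\bigcup_n S(n)$ be the group of finitary permutations of $\{1,2,\dots\}$ and let $\phi:S(\infty)\to\mathbb{C}$ be a central function, i.e. $\phi(g_1g_2)=\phi(g_2g_1)$ for all $g_1,g_2$ (for instance, a central positive-definite function). For a Young diagram $\lambda$ with $n\ge 0$ boxes let $\chi^\lambda$ be the (non-normalized) character of the irreducible representation of $S(n)$ labelled by $\lambda$ (the one-row diagram labelling the trivial representation), and let $$m(\lambda)=\langle\phi|_{S(n)},\chi^\lambda\rangle_{S(n)}=\frac1{n!}\sum_{g\in S(n)}\phi(g)\overline{\chi^\lambda(g)}$$ be the Fourier coefficients of $\phi$, so that $\phi|_{S(n)}=\sum_{|\lambda|=n}m(\lambda)\chi^\lambda$. Write $m(k)=m((k))$ for $k\ge 0$, where $(k)$ is the diagram with one row of $k$ boxes, so that $m(0)=m(\emptyset)$, and $m(k)=0$ for $k<0$. Then $\phi$ is multiplicative in the cycles of a permutation (its value on any permutation is the product of its values on the disjoint nontrivial cycles of that permutation; in particular $\phi(e)=1$) if and only if $$m(\lambda)=\det\big[m(\lambda_i-i+j)\big]_{i,j=1}^{\ell(\lambda)}$$ for every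 Young diagram $\lambda$, where $\ell(\lambda)$ is the number of rows of $\lambda$ (for $\lambda=\emptyset$ this reads $m(\emptyset)=1$). -/

import Mathlib

noncomputable section

namespace InfSym

/-- The infinite symmetric group `S(∞)`, the union of the finite symmetric groups: all
permutations of `ℕ` that fix every sufficiently large number. -/
def SInf : Subgroup (Equiv.Perm ℕ) where
  carrier := {σ | ∃ n : ℕ, ∀ k, n ≤ k → σ k = k}
  one_mem' := ⟨0, fun _ _ => rfl⟩
  mul_mem' := by
    rintro σ τ ⟨a, ha⟩ ⟨b, hb⟩
    refine ⟨max a b, fun k hk => ?_⟩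
    rw [Equiv.Perm.mul_apply, hb k (le_trans (le_max_right a b) hk),
      ha k (le_trans (le_max_left a b) hk)]
  inv_mem' := by
    rintro σ ⟨a, ha⟩
    exact ⟨a, fun k hk => Equiv.Perm.inv_eq_iff_eq.mpr (ha k hk).symm⟩

/-- The inclusion of `S(n)`, the permutations of `{0, …, n - 1}`, into `S(∞)`; the image of `σ`
acts as `σ` on the numbers below `n` and fixes all others. -/
def incl (n : ℕ) : Equiv.Perm (Fin n) →* SInf :=
  (Equiv.Perm.viaEmbeddingHom (Fin.valEmbedding : Fin n ↪ ℕ)).codRestrict SInf (by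
    intro σ
    refine ⟨n, fun k hk => ?_⟩
    rw [Equiv.Perm.viaEmbeddingHom_apply]
    apply Equiv.Perm.viaEmbedding_apply_of_notMem
    rintro ⟨x, rfl⟩
    exact absurd x.isLt (not_lt.mpr hk))

/-- A function on a group is central if `φ (g₁ g₂) = φ (g₂ g₁)` for all `g₁, g₂`. -/
def IsCentral {G : Type*} [Group G] (φ : G → ℂ) : Prop :=
  ∀ g₁ g₂ : G, φ (g₁ * g₂) = φ (g₂ * g₁)

/-- `φ` is multiplicative in the cycles: its value at a product of pairwise disjoint
(nontrivial) cycles is the product of its values at these cycles. Every element of `S(∞)` is such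
a product; the empty list gives `φ 1 = 1`. -/
def IsMultiplicative (φ : SInf → ℂ) : Prop :=
  ∀ l : List SInf,
    (∀ c ∈ l, (c : Equiv.Perm ℕ).IsCycle) →
    l.Pairwise (fun c d => Equiv.Perm.Disjoint (c : Equiv.Perm ℕ) (d : Equiv.Perm ℕ)) →
    φ l.prod = (l.map φ).prod

/-- A bijective numbering of the boxes of the Young diagram `μ` by `{0, …, |μ| - 1}`, that is, a
Young tableau of shape `μ`; it sends a number to the box `(row, column)` containing it. -/
def tableau (μ : YoungDiagram) : Fin μ.card ≃ μ.cells :=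
  μ.cells.equivFin.symm

/-- `σ` permutes the entries of each row of the tableau. -/
def PreservesRows (μ : YoungDiagram) (σ : Equiv.Perm (Fin μ.card)) : Prop :=
  ∀ x, (tableau μ (σ x)).1.1 = (tableau μ x).1.1

/-- `σ` permutes the entries of each column of the tableau. -/
def PreservesCols (μ : YoungDiagram) (σ : Equiv.Perm (Fin μ.card)) : Prop :=
  ∀ x, (tableau μ (σ x)).1.2 = (tableau μ x).1.2

open Classical in
/-- The Young symmetrizer: the sum of the row-preserving permutations times the signed sum of the
column-preserving permutations, in the group algebra `ℂ[S(|μ|)]`. -/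
def youngSymmetrizer (μ : YoungDiagram) : MonoidAlgebra ℂ (Equiv.Perm (Fin μ.card)) :=
  (∑ p : Equiv.Perm (Fin μ.card) with PreservesRows μ p, MonoidAlgebra.of ℂ _ p) *
    ∑ q : Equiv.Perm (Fin μ.card) with PreservesCols μ q,
      ((Equiv.Perm.sign q : ℤ) : ℂ) • MonoidAlgebra.of ℂ _ q

/-- The irreducible `S(|μ|)`-module labelled by `μ`: the left ideal generated by the Young
symmetrizer. -/
abbrev irrepSpace (μ : YoungDiagram) : Ideal (MonoidAlgebra ℂ (Equiv.Perm (Fin μ.card))) :=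
  Ideal.span {youngSymmetrizer μ}

/-- The irreducible representation of `S(|μ|)` labelled by `μ`: left multiplication on the left
ideal generated by the Young symmetrizer. -/
def irrep (μ : YoungDiagram) :
    Representation ℂ (Equiv.Perm (Fin μ.card)) (irrepSpace μ) :=
  Representation.ofModule' (irrepSpace μ)

/-- The (non-normalized) irreducible character `χ^μ` of `S(|μ|)`. -/
def chi (μ : YoungDiagram) (g : Equiv.Perm (Fin μ.card)) : ℂ :=
  LinearMap.trace ℂ (irrepSpace μ) (irrep μ g)

/-- The Hermitian inner product `(1/n!) ∑_g f₁(g) conj (f₂(g))` of functions on `S(n)`. -/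
def innerS (n : ℕ) (f₁ f₂ : Equiv.Perm (Fin n) → ℂ) : ℂ :=
  (1 / (n.factorial : ℂ)) * ∑ g : Equiv.Perm (Fin n), f₁ g * (starRingEnd ℂ) (f₂ g)

/-- The Fourier coefficient `m(μ)` of `φ`: the coefficient of `χ^μ` in the restriction of `φ` to
`S(|μ|)`, computed through the orthonormality of the irreducible characters. -/
def fourierCoeff (φ : SInf → ℂ) (μ : YoungDiagram) : ℂ :=
  innerS μ.card (fun g => φ (incl μ.card g)) (chi μ)

/-- The Young diagram `(k)` with a single row of `k` boxes (the empty diagram if `k = 0`). -/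
def oneRow (k : ℕ) : YoungDiagram :=
  YoungDiagram.ofRowLens [k] (List.pairwise_singleton _ _).sortedGE

/-- `m(k) = m((k))` for `k ≥ 0`, and `m(k) = 0` for `k < 0`. -/
def rowCoeff (φ : SInf → ℂ) (k : ℤ) : ℂ :=
  if k < 0 then 0 else fourierCoeff φ (oneRow k.toNat)

end InfSym

end

/-! Attach to `g` the monomial with one factor `X k` for each `k`-cycle, `k ≥ 2`; this is the power
sum monomial of its cycle type with `p₁ = 1`. A central `φ` depends only on cycle types, so it is `Φ
∘ cycleMonomial` for a linear functional `Φ` on polynomials (`IsCentral.exists_linearMap`).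
Averaging `χ^μ(g) * cycleMonomial g` over `g` gives the Schur function, which by Jacobi–Trudi is
`det [h (μ i - i + j)]`, where `h k` is the cycle index of `S(k)`. Hence `m(μ) = Φ (det [h ..])`
(`fourierCoeff_eq_det`) and `m(k) = Φ (h k)` (`rowCoeff_eq`). The theorem compares `Φ` of a
determinant with the determinant of the values of `Φ`.

If `φ` is multiplicative, `Φ` can be replaced by an algebra homomorphism, which commutes with
determinants. Conversely, in the expansion of the determinant every term other than the diagonal one
has a larger sum of squared indices, so induction shows that `Φ` is multiplicative on products of
the `h k` (`map_prod_cycleIndex`). These generate every `X k` with `k ≥ 2`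
(`X_mem_adjoin_cycleIndex`), so `φ` is multiplicative in cycles.

Most of the work is Jacobi–Trudi for the module spanned by the Young symmetrizer (`chi_eq_detChar`).
Let `D` be the alternating sum of permutation characters on colourings. The Cauchy determinant gives
`⟨D, D⟩ = 1`; quasi-idempotence and primitivity of the symmetrizer give `⟨χ, χ⟩ = 1`; the
combinatorics of column-injective colourings gives `⟨D, χ⟩ = 1`. All values are real, so `‖χ - D‖² =
1 - 2 + 1 = 0`. -/

noncomputable section

namespace InfSym

open Equiv

/-! ### Cycle indices and permutation characters on colourings. -/

section CycleIndex

variable {X : Type*} [Fintype X] [DecidableEq X]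

/-- The monomial recording the cycle type of a permutation. -/
def cycleMonomial (g : Perm X) : MvPolynomial ℕ ℂ :=
  (g.cycleType.map MvPolynomial.X).prod

theorem cycleMonomial_one : cycleMonomial (1 : Perm X) = 1 := by
  simp [cycleMonomial]

theorem cycleMonomial_mul {g h : Perm X} (hd : g.Disjoint h) :
    cycleMonomial (g * h) = cycleMonomial g * cycleMonomial h := by
  simp [cycleMonomial, hd.cycleType_mul]

theorem cycleMonomial_ofSubtype {p : X → Prop} [DecidablePred p] (g : Perm (Subtype p)) :
    cycleMonomial (Perm.ofSubtype g) = cycleMonomial g := by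
  simp [cycleMonomial, Perm.cycleType_ofSubtype]

theorem cycleMonomial_permCongr {Y : Type*} [Fintype Y] [DecidableEq Y] (e : X ≃ Y)
    (g : Perm X) : cycleMonomial (e.permCongr g) = cycleMonomial g := by
  have h : e.permCongr g = g.extendDomain (e.trans (Equiv.Set.univ Y).symm) := by
    ext y
    obtain ⟨x, rfl⟩ := e.surjective y
    have := Perm.extendDomain_apply_image g (e.trans (Equiv.Set.univ Y).symm) x
    simp at this
    simp [this]
  rw [cycleMonomial, h, Perm.cycleType_extendDomain, cycleMonomial]

/-- The sum of the cycle monomials over `S(k)`. -/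
def cycleSum (k : ℕ) : MvPolynomial ℕ ℂ :=
  ∑ g : Perm (Fin k), cycleMonomial g

theorem sum_cycleMonomial :
    ∑ g : Perm X, cycleMonomial g = cycleSum (Fintype.card X) := by
  refine Fintype.sum_equiv (Fintype.equivFin X).permCongr _ _ fun g => ?_
  rw [cycleMonomial_permCongr]

/-- The cycle monomial factors over the fibres of an invariant colouring. -/
theorem cycleMonomial_eq_prod {K : Type*} [Fintype K] [DecidableEq K] (f : X → K) (g : Perm X)
    (hg : ∀ x, f (g x) = f x) :
    cycleMonomial g = ∏ k, cycleMonomial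
      (g.subtypePerm (p := fun x => f x = k) fun x => by rw [hg x]) := by
  -- Generalized to a set `t` of colours, so that fibres are added one at a time; the part of `g` on
  -- a new fibre is disjoint from the part already treated.
  have key : ∀ t : Finset K, cycleMonomial
      (Perm.ofSubtype (g.subtypePerm (p := fun x => f x ∈ t) fun x => by rw [hg x])) =
      ∏ k ∈ t, cycleMonomial (g.subtypePerm (p := fun x => f x = k) fun x => by rw [hg x]) := by
    intro t
    induction t using Finset.induction_on with
    | empty =>
      rw [Finset.prod_empty, ← cycleMonomial_one (X := X)]
      congr 1
    | insert k t hk ih =>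
      rw [Finset.prod_insert hk, ← ih, ← cycleMonomial_ofSubtype, ← cycleMonomial_mul]
      · congr 1
        ext x
        rw [Perm.mul_apply]
        by_cases h1 : f x = k
        · rw [Perm.ofSubtype_apply_of_mem _ (by simp [h1]),
            Perm.ofSubtype_apply_of_not_mem (p := fun x => f x ∈ t) _ (by simpa [h1] using hk),
            Perm.ofSubtype_apply_of_mem (p := fun x => f x = k) _ h1]
          rfl
        · by_cases h2 : f x ∈ t
          · rw [Perm.ofSubtype_apply_of_mem _ (by simp [h2]),
              Perm.ofSubtype_apply_of_mem (p := fun x => f x ∈ t) _ h2,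
              Perm.ofSubtype_apply_of_not_mem (p := fun x => f x = k) _
                (by simpa [hg] using h1)]
            rfl
          · rw [Perm.ofSubtype_apply_of_not_mem _ (by simp [h1, h2]),
              Perm.ofSubtype_apply_of_not_mem (p := fun x => f x ∈ t) _ h2,
              Perm.ofSubtype_apply_of_not_mem (p := fun x => f x = k) _ h1]
      · intro x
        by_cases h1 : f x = k
        · right
          rw [Perm.ofSubtype_apply_of_not_mem (p := fun x => f x ∈ t) _ (by simpa [h1] using hk)]
        · left
          rw [Perm.ofSubtype_apply_of_not_mem (p := fun x => f x = k) _ h1]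
  rw [← key Finset.univ]
  congr 1
  ext x
  rw [Perm.ofSubtype_apply_of_mem _ (by simp)]
  rfl

/-- The stabilizer of a colouring is the product of the symmetric groups of the fibres. -/
def stabilizerEquivPi {K : Type*} (f : X → K) :
    {g : Perm X // f ∘ g = f} ≃ ∀ k, Perm {x // f x = k} where
  toFun g k := g.1.subtypePerm fun x => by rw [← congrFun g.2 x]; rfl
  invFun h := ⟨DomMulAct.stabilizerEquiv_invFun_aux h, by
    ext x; exact DomMulAct.comp_stabilizerEquiv_invFun h x⟩
  left_inv _ := rfl
  right_inv h := by
    ext k x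
    exact DomMulAct.stabilizerEquiv_invFun_eq h x.2

/-- The stabilizer is a product over the fibres and the cycle monomial factors accordingly, so the
sum of products is a product of sums. -/
theorem sum_stabilizer_cycleMonomial {K : Type*} [Fintype K] [DecidableEq K] (f : X → K) :
    ∑ g ∈ Finset.univ.filter (fun g : Perm X => f ∘ g = f), cycleMonomial g =
      ∏ k, cycleSum (Fintype.card {x // f x = k}) := by
  calc ∑ g ∈ Finset.univ.filter (fun g : Perm X => f ∘ g = f), cycleMonomial g
      = ∑ g : {g : Perm X // f ∘ g = f}, cycleMonomial g.1 :=
        (Finset.sum_subtype _ (by simp) _)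
    _ = ∑ h : ∀ k, Perm {x // f x = k}, ∏ k, cycleMonomial (h k) := by
        refine Fintype.sum_equiv (stabilizerEquivPi f) _ _ fun g => ?_
        exact cycleMonomial_eq_prod f g.1 fun x => congrFun g.2 x
    _ = ∏ k, ∑ h : Perm {x // f x = k}, cycleMonomial h := by
        rw [Finset.prod_univ_sum, Fintype.piFinset_univ]
    _ = _ := by simp_rw [sum_cycleMonomial]

/-- The number of colourings with prescribed fibre sizes. -/
theorem card_colourings_mul {K : Type*} [Fintype K] [DecidableEq K] (M : K → ℕ)
    (hM : ∑ k, M k = Fintype.card X) :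
    (Finset.univ.filter fun f : X → K => ∀ k, Fintype.card {x // f x = k} = M k).card *
      ∏ k, (M k).factorial = (Fintype.card X).factorial := by
  have e : X ≃ Σ k, Fin (M k) := Fintype.equivOfCardEq (by simp [hM])
  let f₀ : X → K := fun x => (e x).1
  have h₀ : ∀ k, Fintype.card {x // f₀ x = k} = M k := by
    intro k
    rw [← Fintype.card_fin (M k)]
    refine Fintype.card_congr ((e.subtypeEquiv fun x => Iff.rfl).trans (Equiv.sigmaSubtype k))
  rw [← Fintype.card_perm, ← Finset.card_univ,
    Finset.card_eq_sum_card_fiberwise (f := fun g : Perm X => f₀ ∘ g)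
      (t := Finset.univ.filter fun f : X → K => ∀ k, Fintype.card {x // f x = k} = M k)]
  · rw [Finset.sum_const_nat]
    intro f hf
    simp only [Finset.mem_filter, Finset.mem_univ, true_and] at hf ⊢
    -- The permutations are counted by the colouring `f₀ ∘ g`. The fibre over `f` is the coset `g₀ *
    -- Stab f`, whose size is the product of the factorials.
    let g₀ : Perm X := Equiv.ofFiberEquiv (f := f) (g := f₀) fun k =>
      Fintype.equivOfCardEq (by rw [hf, h₀])
    have hg₀ : f₀ ∘ g₀ = f := by
      ext x; exact Equiv.ofFiberEquiv_map _ x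
    have := DomMulAct.stabilizer_card f
    simp only [hf] at this
    rw [← this, Fintype.card_subtype]
    refine Finset.card_bij' (fun g _ => g₀⁻¹ * g) (fun g _ => g₀ * g) ?_ ?_ ?_ ?_
    · intro g hg
      simp only [Finset.mem_filter, Finset.mem_univ, true_and] at hg ⊢
      rw [← hg₀, Function.comp_assoc, ← Perm.coe_mul, mul_inv_cancel_left, hg, hg₀]
    · intro g hg
      simp only [Finset.mem_filter, Finset.mem_univ, true_and] at hg ⊢
      rw [Perm.coe_mul, ← Function.comp_assoc, hg₀, hg]
    · simp
    · simp
  · intro g _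
    simp only [Finset.coe_filter, Finset.mem_univ, true_and, Set.mem_ofPred_eq]
    intro k
    rw [← h₀ k]
    exact Fintype.card_congr (g.subtypeEquiv fun x => Iff.rfl)

/-- The cycle index of `S(k)`, i.e. the complete symmetric function `h_k` with `p_1 = 1`. -/
def cycleIndex (k : ℕ) : MvPolynomial ℕ ℂ :=
  ((k.factorial : ℂ)⁻¹) • cycleSum k

/-- The cycle index, extended by zero to negative arguments. -/
def cycleIndexInt (k : ℤ) : MvPolynomial ℕ ℂ :=
  if k < 0 then 0 else cycleIndex k.toNat

theorem cycleIndexInt_natCast (k : ℕ) : cycleIndexInt k = cycleIndex k := by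
  rw [cycleIndexInt, if_neg (by omega), Int.toNat_natCast]

theorem cycleSum_eq (k : ℕ) : cycleSum k = (k.factorial : ℂ) • cycleIndex k := by
  rw [cycleIndex, smul_smul, mul_inv_cancel₀ (by exact_mod_cast k.factorial_ne_zero), one_smul]

/-- The colourings with fibre sizes `α` that are fixed by `g`. -/
def fixedColourings {K : Type*} [Fintype K] [DecidableEq K] (α : K → ℤ) (g : Perm X) :
    Finset (X → K) :=
  Finset.univ.filter fun f =>
    (∀ k, (Fintype.card {x // f x = k} : ℤ) = α k) ∧ f ∘ g = f

/-- The permutation character of `Perm X` on the colourings with fibre sizes `α`. -/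
def permChar {K : Type*} [Fintype K] [DecidableEq K] (α : K → ℤ) (g : Perm X) : ℤ :=
  (fixedColourings α g).card

/-- The Frobenius characteristic of a permutation character is a product of complete symmetric
functions. After exchanging the sums, each colouring contributes its stabilizer sum `∏ (α k)! • h (α
k)`, and there are `n! / ∏ (α k)!` colourings. A negative `α k` makes both sides vanish. -/
theorem sum_permChar_smul_cycleMonomial {K : Type*} [Fintype K] [DecidableEq K] (α : K → ℤ)
    (hα : ∑ k, α k = Fintype.card X) :
    ∑ g : Perm X, (permChar α g : ℂ) • cycleMonomial g =
      ((Fintype.card X).factorial : ℂ) • ∏ k, cycleIndexInt (α k) := by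
  by_cases hneg : ∃ k, α k < 0
  · obtain ⟨k, hk⟩ := hneg
    rw [Finset.prod_eq_zero (Finset.mem_univ k) (by simp [cycleIndexInt, hk]), smul_zero]
    refine Finset.sum_eq_zero fun g _ => ?_
    have : permChar α g = 0 := by
      rw [permChar, Nat.cast_eq_zero, Finset.card_eq_zero, fixedColourings,
        Finset.filter_eq_empty_iff]
      rintro f - ⟨h, -⟩
      have := h k
      omega
    simp [this]
  · push Not at hneg
    lift α to K → ℕ using hneg
    have hα' : ∑ k, α k = Fintype.card X := by
      have h := hα
      dsimp only at h
      exact_mod_cast h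
    have h1 : ∀ g : Perm X, (permChar (fun k => (α k : ℤ)) g : ℂ) • cycleMonomial g =
        ∑ f : X → K with (∀ k, Fintype.card {x // f x = k} = α k),
          if f ∘ g = f then cycleMonomial g else 0 := by
      intro g
      rw [← Finset.sum_filter, Finset.filter_filter, Finset.sum_const, permChar, fixedColourings]
      simp [Nat.cast_smul_eq_nsmul]
    simp_rw [h1]
    rw [Finset.sum_comm]
    simp_rw [← Finset.sum_filter, sum_stabilizer_cycleMonomial]
    rw [Finset.sum_congr rfl (g := fun _ => ∏ k, cycleSum (α k))]
    · rw [Finset.sum_const, ← card_colourings_mul α hα']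
      simp_rw [cycleSum_eq, Finset.prod_smul, cycleIndexInt_natCast]
      simp [← Nat.cast_smul_eq_nsmul ℂ, smul_smul]
    · intro f hf
      simp only [Finset.mem_filter, Finset.mem_univ, true_and] at hf
      simp_rw [hf]

theorem aeval_one_cycleMonomial (g : Perm X) :
    MvPolynomial.aeval (fun _ => (1 : ℂ)) (cycleMonomial g) = 1 := by
  rw [cycleMonomial, map_multiset_prod, Multiset.map_map]
  simp

theorem aeval_one_cycleIndex (k : ℕ) :
    MvPolynomial.aeval (fun _ => (1 : ℂ)) (cycleIndex k) = 1 := by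
  rw [cycleIndex, cycleSum, map_smul, map_sum]
  simp only [aeval_one_cycleMonomial, Finset.sum_const, Finset.card_univ, Fintype.card_perm,
    Fintype.card_fin, nsmul_eq_mul, mul_one, smul_eq_mul]
  exact inv_mul_cancel₀ (by exact_mod_cast k.factorial_ne_zero)

/-- Setting all variables to `1` sends each `h k` to `1`. This is Burnside's count for a transitive
action. -/
theorem sum_permChar {K : Type*} [Fintype K] [DecidableEq K] (M : K → ℕ)
    (hM : ∑ k, M k = Fintype.card X) :
    ∑ g : Perm X, permChar (fun k => (M k : ℤ)) g = (Fintype.card X).factorial := by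
  have h := congrArg (MvPolynomial.aeval (fun _ => (1 : ℂ)))
    (sum_permChar_smul_cycleMonomial (X := X) (fun k => (M k : ℤ)) (by exact_mod_cast hM))
  simp only [map_sum, map_smul, map_prod, aeval_one_cycleMonomial, cycleIndexInt_natCast,
    aeval_one_cycleIndex, Finset.prod_const_one, smul_eq_mul, mul_one] at h
  exact_mod_cast h

end CycleIndex

/-! ### The Cauchy determinant. -/

section Cauchy

variable {R : Type*} [CommRing R]

/-- The Cauchy determinant, in a division-free form. -/
theorem det_cauchy {n : ℕ} (x y : Fin n → R) (G : Matrix (Fin n) (Fin n) R)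
    (hG : ∀ i j, G i j * (1 - x i * y j) = 1) :
    G.det = (Matrix.vandermonde x).det * (Matrix.vandermonde y).det * ∏ i, ∏ j, G i j := by
  rw [Matrix.det_vandermonde, Matrix.det_vandermonde]
  induction n with
  | zero => simp
  | succ n ih =>
    -- With `G i j = 1 / (1 - x i * y j)`, subtracting row `0` gives `G i j - G 0 j = (x i - x 0) *
    -- y j * G i j * G 0 j`; `C` is what remains after extracting `G 0 j` and `x i - x 0`. `D` is
    -- `C` after subtracting column `0`, where `y j * G i j - y 0 * G i 0 = (y j - y 0) * G i j * G
    -- i 0`.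
    let C : Matrix (Fin (n + 1)) (Fin (n + 1)) R :=
      Matrix.of fun i j => Fin.cases 1 (fun i => y j * G i.succ j) i
    let D : Matrix (Fin (n + 1)) (Fin (n + 1)) R :=
      Matrix.of fun i j => Fin.cases (C i 0) (fun j => C i j.succ - C i 0) j
    let d : Fin (n + 1) → R := Fin.cases 1 fun i => x i.succ - x 0
    have h1 : G.det = (Matrix.of fun i j => G 0 j * (Matrix.of fun i j => d i * C i j) i j).det := by
      refine Matrix.det_eq_of_forall_row_eq_smul_add_const (Fin.cases 0 fun _ => 1) 0 rfl ?_
      intro i j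
      refine Fin.cases ?_ (fun i => ?_) i
      · simp [d, C]
      · simp only [d, C, Matrix.of_apply, Fin.cases_succ, Fin.cases_zero]
        linear_combination G 0 j * hG i.succ j - G i.succ j * hG 0 j
    have h2 : C.det = D.det := by
      rw [← Matrix.det_transpose C, ← Matrix.det_transpose D]
      refine Matrix.det_eq_of_forall_row_eq_smul_add_const (Fin.cases 0 fun _ => 1) 0 rfl ?_
      intro j i
      refine Fin.cases ?_ (fun j => ?_) j
      · simp [D]
      · simp [D]
    have h3 : D.det = (Matrix.of fun i j => G i.succ 0 * (Matrix.of fun (i j : Fin n) =>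
        (y j.succ - y 0) * (Matrix.of fun i j : Fin n => G i.succ j.succ) i j) i j).det := by
      rw [Matrix.det_succ_row_zero, Fin.sum_univ_succ]
      have : ∀ i : Fin n, D 0 i.succ = 0 := by intro i; simp [D, C]
      simp only [this, mul_zero, zero_mul, Finset.sum_const_zero, add_zero]
      have h0 : D 0 0 = 1 := by simp [D, C]
      rw [h0]
      simp only [Fin.val_zero, pow_zero, one_mul, Fin.succAbove_zero]
      congr 1
      ext i j
      simp only [Matrix.submatrix_apply, Matrix.of_apply, D, C, Fin.cases_succ]
      linear_combination y 0 * G i.succ 0 * hG i.succ j.succ -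
        y j.succ * G i.succ j.succ * hG i.succ 0
    have h4 := ih (fun i => x i.succ) (fun i => y i.succ) (Matrix.of fun i j => G i.succ j.succ)
      fun i j => hG _ _
    rw [h1, Matrix.det_mul_row, Matrix.det_mul_column, h2, h3, Matrix.det_mul_column,
      Matrix.det_mul_row, h4]
    simp only [Fin.prod_univ_succ, Fin.prod_Ioi_zero, Fin.prod_Ioi_succ, d, Fin.cases_zero,
      Fin.cases_succ, Matrix.of_apply, Finset.prod_mul_distrib]
    ring

end Cauchy

/-! ### Products of geometric series. -/

section Geometric

variable {σ : Type*}

open MvPowerSeries in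
/-- The power series `∑ k, X ^ (k • m)`. -/
def geomSeries (m : σ →₀ ℕ) : MvPowerSeries σ ℤ :=
  open Classical in fun d => if ∃ k : ℕ, d = k • m then 1 else 0

open Classical in
theorem coeff_geomSeries (m d : σ →₀ ℕ) :
    MvPowerSeries.coeff d (geomSeries m) = if ∃ k : ℕ, d = k • m then 1 else 0 := rfl

theorem geomSeries_mul {m : σ →₀ ℕ} (hm : m ≠ 0) :
    geomSeries m * (1 - MvPowerSeries.monomial m 1) = 1 := by
  classical
  ext d
  rw [mul_sub, mul_one, map_sub, MvPowerSeries.coeff_mul_monomial, mul_one, coeff_geomSeries,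
    coeff_geomSeries, MvPowerSeries.coeff_one]
  by_cases h : ∃ k : ℕ, d = k • m
  · obtain ⟨k, rfl⟩ := h
    rw [if_pos ⟨k, rfl⟩]
    cases k with
    | zero => simp [hm]
    | succ k =>
      have h1 : m ≤ (k + 1) • m := by rw [succ_nsmul]; exact le_add_self
      have h2 : (k + 1) • m - m = k • m := by rw [succ_nsmul, add_tsub_cancel_right]
      rw [if_pos h1, if_pos ⟨k, h2⟩, if_neg (by simp [hm]), sub_self]
  · rw [if_neg h, if_neg (c := d = 0) (fun h0 => h ⟨0, by simp [h0]⟩)]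
    by_cases h1 : m ≤ d
    · rw [if_pos h1, if_neg, sub_zero]
      rintro ⟨k, hk⟩
      exact h ⟨k + 1, by rw [succ_nsmul, ← hk, tsub_add_cancel_of_le h1]⟩
    · rw [if_neg h1, sub_zero]

/-- The coefficients of a product of geometric series count the vectors in a polytope. -/
theorem coeff_prod_geomSeries {κ : Type*} [Fintype κ] [DecidableEq κ] (m : κ → σ →₀ ℕ)
    (hm : ∀ p, m p ≠ 0) (d : σ →₀ ℕ) (S : Finset (κ → ℕ))
    (hS : ∀ M, M ∈ S ↔ ∑ p, M p • m p = d) :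
    MvPowerSeries.coeff d (∏ p, geomSeries (m p)) = S.card := by
  classical
  rw [MvPowerSeries.coeff_prod]
  simp_rw [coeff_geomSeries]
  rw [Finset.sum_congr rfl fun l _ => Finset.prod_ite_zero (s := Finset.univ)
    (p := fun i => ∃ k : ℕ, l i = k • m i) (f := fun _ => (1 : ℤ))]
  simp only [Finset.prod_const_one, Finset.sum_boole]
  congr 1
  symm
  refine Finset.card_bij (fun M _ => Finsupp.equivFunOnFinite.symm fun p => M p • m p) ?_ ?_ ?_
  · intro M hM
    rw [hS] at hM
    simp only [Finset.mem_filter, Finset.mem_finsuppAntidiag, Finset.mem_univ, forall_const]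
    exact ⟨⟨hM, by simp⟩, fun p => ⟨M p, rfl⟩⟩
  · intro M _ M' _ h
    ext p
    have := DFunLike.congr_fun h p
    simp only [Finsupp.equivFunOnFinite_symm_apply_apply] at this
    obtain ⟨i, hi⟩ := Finsupp.ne_iff.1 (hm p)
    have := DFunLike.congr_fun this i
    simpa [show m p i ≠ 0 from hi] using this
  · intro l hl
    simp only [Finset.mem_filter, Finset.mem_finsuppAntidiag, Finset.mem_univ, forall_const] at hl
    choose M hM using hl.2
    refine ⟨M, ?_, ?_⟩
    · rw [hS, ← hl.1.1]
      exact Finset.sum_congr rfl fun p _ => (hM p).symm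
    · ext1 p
      exact (hM p).symm

end Geometric

/-! ### Contingency tables and inner products of permutation characters. -/

section Tables

variable {K : Type*} [Fintype K] [DecidableEq K]

/-- The matrices of natural numbers with sum `N` and given row and column sums. -/
def contingencyTables (N : ℕ) (α β : K → ℤ) : Finset (K × K → ℕ) :=
  (Finset.piAntidiag Finset.univ N).filter fun M =>
    (∀ k, ∑ j, (M (k, j) : ℤ) = α k) ∧ ∀ j, ∑ k, (M (k, j) : ℤ) = β j

theorem mem_contingencyTables {N : ℕ} {α β : K → ℤ} {M : K × K → ℕ} :
    M ∈ contingencyTables N α β ↔ ∑ p, M p = N ∧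
      (∀ k, ∑ j, (M (k, j) : ℤ) = α k) ∧ ∀ j, ∑ k, (M (k, j) : ℤ) = β j := by
  simp [contingencyTables]

theorem card_fibre_fst {X : Type*} [Fintype X] (F : X → K × K) (k : K) :
    Fintype.card {x // (F x).1 = k} = ∑ j, Fintype.card {x // F x = (k, j)} := by
  simp only [Fintype.card_subtype]
  rw [Finset.card_eq_sum_card_fiberwise (f := fun x => (F x).2) (t := Finset.univ)
    (fun _ _ => Finset.mem_coe.2 (Finset.mem_univ _))]
  refine Finset.sum_congr rfl fun j _ => ?_
  rw [Finset.filter_filter]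
  simp only [Prod.ext_iff]

theorem card_fibre_snd {X : Type*} [Fintype X] (F : X → K × K) (j : K) :
    Fintype.card {x // (F x).2 = j} = ∑ k, Fintype.card {x // F x = (k, j)} := by
  simp only [Fintype.card_subtype]
  rw [Finset.card_eq_sum_card_fiberwise (f := fun x => (F x).1) (t := Finset.univ)
    (fun _ _ => Finset.mem_coe.2 (Finset.mem_univ _))]
  refine Finset.sum_congr rfl fun k _ => ?_
  rw [Finset.filter_filter]
  simp only [Prod.ext_iff, and_comm]

variable {X : Type*} [Fintype X] [DecidableEq X]

/-- A pair of fixed colourings is one fixed colouring by pairs; it is classified by the table of its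
fibre sizes, whose margins are `α` and `β`. -/
theorem permChar_mul_permChar (α β : K → ℤ) (g : Perm X) :
    permChar α g * permChar β g =
      ∑ M ∈ contingencyTables (Fintype.card X) α β, permChar (fun p => (M p : ℤ)) g := by
  simp only [permChar]
  rw [← Nat.cast_mul, ← Finset.card_product, ← Nat.cast_sum, Nat.cast_inj]
  let T : Finset (X → K × K) := Finset.univ.filter fun F =>
    ((fun x => (F x).1) ∈ fixedColourings α g) ∧ (fun x => (F x).2) ∈ fixedColourings β g
  have hT : (fixedColourings α g ×ˢ fixedColourings β g).card = T.card := by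
    refine Finset.card_bij' (fun p _ x => (p.1 x, p.2 x)) (fun F _ => (fun x => (F x).1, fun x => (F x).2))
      ?_ ?_ ?_ ?_
    · intro p hp
      simpa [T] using hp
    · intro p hp
      simpa [T] using hp
    · simp
    · simp
  rw [hT, Finset.card_eq_sum_card_fiberwise
    (f := fun F : X → K × K => fun p => Fintype.card {x // F x = p})
    (t := contingencyTables (Fintype.card X) α β)]
  · refine Finset.sum_congr rfl fun M hM => congrArg _ ?_
    ext F
    rw [mem_contingencyTables] at hM
    simp only [T, fixedColourings, Finset.mem_filter, Finset.mem_univ, true_and, funext_iff,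
      Function.comp_apply, Nat.cast_inj]
    constructor
    · rintro ⟨⟨⟨-, h1⟩, -, h2⟩, h3⟩
      exact ⟨h3, fun x => Prod.ext (h1 x) (h2 x)⟩
    · rintro ⟨h3, h4⟩
      refine ⟨⟨⟨fun k => ?_, fun x => by rw [h4]⟩, fun k => ?_, fun x => by rw [h4]⟩, h3⟩
      · rw [card_fibre_fst, ← hM.2.1 k]
        simp [h3]
      · rw [card_fibre_snd, ← hM.2.2 k]
        simp [h3]
  · intro F hF
    simp only [T, fixedColourings, Finset.coe_filter, Finset.mem_univ, true_and,
      Set.mem_ofPred_eq, Finset.mem_filter] at hF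
    rw [Finset.mem_coe, mem_contingencyTables]
    refine ⟨?_, fun k => ?_, fun k => ?_⟩
    · simp only [Fintype.card_subtype]
      rw [← Finset.card_univ, ← Finset.card_eq_sum_card_fiberwise]
      exact fun _ _ => Finset.mem_coe.2 (Finset.mem_univ _)
    · rw [← hF.1.1 k, card_fibre_fst]
      simp
    · rw [← hF.2.1 k, card_fibre_snd]
      simp

theorem sum_permChar_mul_permChar (α β : K → ℤ) :
    ∑ g : Perm X, permChar α g * permChar β g =
      (Fintype.card X).factorial * (contingencyTables (Fintype.card X) α β).card := by
  simp_rw [permChar_mul_permChar]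
  rw [Finset.sum_comm, Finset.sum_congr rfl (g := fun _ => ((Fintype.card X).factorial : ℤ))]
  · rw [Finset.sum_const, nsmul_eq_mul, mul_comm]
  · intro M hM
    exact sum_permChar M (mem_contingencyTables.1 hM).1

end Tables

/-! ### The determinantal virtual character has norm one. -/

section Orthonormality

variable {n : ℕ}

/-- The exponent vector of the monomial `x ^ a * y ^ b`. -/
def pairExponent (a b : Fin n → ℕ) : Fin n ⊕ Fin n →₀ ℕ :=
  Finsupp.equivFunOnFinite.symm (Sum.elim a b)

/-- The exponent vector of the monomial `x i * y j`. -/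
def boxExponent (p : Fin n × Fin n) : Fin n ⊕ Fin n →₀ ℕ :=
  Finsupp.single (Sum.inl p.1) 1 + Finsupp.single (Sum.inr p.2) 1

theorem boxExponent_inl (p : Fin n × Fin n) (i : Fin n) :
    boxExponent p (Sum.inl i) = if p.1 = i then 1 else 0 := by
  simp [boxExponent, Finsupp.single_apply]

theorem boxExponent_inr (p : Fin n × Fin n) (i : Fin n) :
    boxExponent p (Sum.inr i) = if p.2 = i then 1 else 0 := by
  simp [boxExponent, Finsupp.single_apply]

theorem boxExponent_ne_zero (p : Fin n × Fin n) : boxExponent p ≠ 0 := by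
  intro h
  have := DFunLike.congr_fun h (Sum.inl p.1)
  simp [boxExponent_inl] at this

theorem prod_X_pow_eq_monomial (w v : Fin n → ℕ) :
    (∏ i, (MvPowerSeries.X (Sum.inl i) : MvPowerSeries (Fin n ⊕ Fin n) ℤ) ^ w i) *
      ∏ i, (MvPowerSeries.X (Sum.inr i) : MvPowerSeries (Fin n ⊕ Fin n) ℤ) ^ v i =
      MvPowerSeries.monomial (pairExponent w v) 1 := by
  have h : MvPolynomial.monomial (pairExponent w v) (1 : ℤ) =
      (∏ i, MvPolynomial.X (Sum.inl i) ^ w i) * ∏ i, MvPolynomial.X (Sum.inr i) ^ v i := by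
    rw [MvPolynomial.monomial_eq, Finsupp.prod_fintype _ _ (by simp), Fintype.prod_sum_type]
    simp [pairExponent]
  rw [← MvPolynomial.coe_monomial, h]
  simp only [← MvPolynomial.coeToMvPowerSeries.ringHom_apply, map_mul, map_prod, map_pow]
  simp

/-- The signed count of contingency tables behind the orthonormality of the Schur functions. -/
theorem sum_sign_card_contingencyTables (L : Fin n → ℕ) (hL : Function.Injective L) (N : ℕ)
    (hN : ∑ i, L i = N + ∑ i : Fin n, (i : ℕ)) :
    ∑ w : Perm (Fin n), ∑ v : Perm (Fin n), ((Perm.sign w : ℤ) * (Perm.sign v : ℤ)) *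
      ((contingencyTables N (fun i => (L i : ℤ) - (w i : ℕ))
        (fun i => (L i : ℤ) - (v i : ℕ))).card : ℤ) = 1 := by
  classical
  let x : Fin n → MvPowerSeries (Fin n ⊕ Fin n) ℤ := fun i => MvPowerSeries.X (Sum.inl i)
  let y : Fin n → MvPowerSeries (Fin n ⊕ Fin n) ℤ := fun i => MvPowerSeries.X (Sum.inr i)
  let G : Matrix (Fin n) (Fin n) (MvPowerSeries (Fin n ⊕ Fin n) ℤ) :=
    Matrix.of fun i j => geomSeries (boxExponent (i, j))
  have hxy : ∀ i j, x i * y j = MvPowerSeries.monomial (boxExponent (i, j)) 1 := by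
    intro i j
    simp only [x, y, MvPowerSeries.X, MvPowerSeries.monomial_mul_monomial, mul_one, boxExponent]
  have hdet := det_cauchy x y G fun i j => by
    rw [hxy]; exact geomSeries_mul (boxExponent_ne_zero _)
  -- The identity is read off as the coefficient of `x ^ L * y ^ L` in the Cauchy determinant. On
  -- the determinant side, the term of `w` has equal exponents at `x (w i)` and `y i`; thus `L (w i)
  -- = L i`, and injectivity leaves only `w = 1`.
  have hl : MvPowerSeries.coeff (pairExponent L L) G.det = 1 := by
    rw [Matrix.det_apply, map_sum, Finset.sum_eq_single 1]
    · simp only [G, Matrix.of_apply, Perm.sign_one, one_smul, Perm.one_apply]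
      rw [coeff_prod_geomSeries (fun i : Fin n => boxExponent (i, i))
        (fun _ => boxExponent_ne_zero _) _ {L}]
      · simp
      · intro M
        rw [Finset.mem_singleton]
        constructor
        · rintro rfl
          ext (i | i) <;>
          simp [boxExponent_inl, boxExponent_inr, pairExponent, Finsupp.finsetSum_apply]
        · intro h
          ext i
          have := DFunLike.congr_fun h (Sum.inl i)
          simpa [boxExponent_inl, pairExponent, Finsupp.finsetSum_apply] using this
    · intro w _ hw
      rw [map_zsmul_unit]
      simp only [G, Matrix.of_apply]
      rw [coeff_prod_geomSeries (fun i : Fin n => boxExponent (w i, i))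
        (fun _ => boxExponent_ne_zero _) _ ∅]
      · simp
      · intro M
        simp only [Finset.notMem_empty, false_iff]
        intro h
        apply hw
        ext i : 1
        apply hL
        have h1 := DFunLike.congr_fun h (Sum.inl (w i))
        have h2 := DFunLike.congr_fun h (Sum.inr i)
        simp [boxExponent_inl, boxExponent_inr, pairExponent, Finsupp.finsetSum_apply] at h1 h2
        rw [Perm.one_apply, ← h1, ← h2]
    · simp
  -- On the product side, the Vandermonde determinants give signed monomials `x ^ w * y ^ v`, and
  -- the remaining coefficient of `∏ G i j` counts tables with margins `L - w` and `L - v`.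
  rw [← hl, hdet, ← Matrix.det_transpose, ← Matrix.det_transpose (Matrix.vandermonde y),
    Matrix.det_apply', Matrix.det_apply', Finset.sum_mul_sum, Finset.sum_mul, map_sum]
  refine Finset.sum_congr rfl fun w _ => ?_
  rw [Finset.sum_mul, map_sum]
  refine Finset.sum_congr rfl fun v _ => ?_
  have h1 : ((Perm.sign w : ℤ) : MvPowerSeries (Fin n ⊕ Fin n) ℤ) *
      (∏ i, (Matrix.vandermonde x).transpose (w i) i) *
      (((Perm.sign v : ℤ) : MvPowerSeries (Fin n ⊕ Fin n) ℤ) *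
      ∏ i, (Matrix.vandermonde y).transpose (v i) i) * ∏ i, ∏ j, G i j =
      MvPowerSeries.C ((Perm.sign w : ℤ) * (Perm.sign v : ℤ)) *
      (MvPowerSeries.monomial (pairExponent (fun i => w i) (fun i => v i)) 1 *
        ∏ p : Fin n × Fin n, geomSeries (boxExponent p)) := by
    rw [← prod_X_pow_eq_monomial, Fintype.prod_prod_type]
    have hC : ∀ z : ℤ, MvPowerSeries.C z = (z : MvPowerSeries (Fin n ⊕ Fin n) ℤ) :=
      fun z => eq_intCast MvPowerSeries.C z
    simp only [Matrix.transpose_apply, Matrix.vandermonde_apply, G, Matrix.of_apply, Int.cast_mul, hC,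
      x, y]
    ring
  rw [h1, MvPowerSeries.coeff_C_mul, MvPowerSeries.coeff_monomial_mul, one_mul]
  congr 1
  have hle : pairExponent (fun i => w i) (fun i => v i) ≤ pairExponent L L ↔
      (∀ i, (w i : ℕ) ≤ L i) ∧ ∀ i, (v i : ℕ) ≤ L i := by
    rw [Finsupp.le_def]
    simp [pairExponent]
  split_ifs with h
  · rw [coeff_prod_geomSeries _ boxExponent_ne_zero]
    intro M
    rw [hle] at h
    have hsum : ∑ i, (w i : ℕ) = ∑ i : Fin n, (i : ℕ) := Equiv.sum_comp w fun i => (i : ℕ)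
    have e1 : ∀ i, (∑ p, M p • boxExponent p) (Sum.inl i) = ∑ j, M (i, j) := by
      intro i
      simp [Finsupp.finsetSum_apply, boxExponent_inl, Fintype.sum_prod_type]
    have e2 : ∀ i, (∑ p, M p • boxExponent p) (Sum.inr i) = ∑ j, M (j, i) := by
      intro i
      simp [Finsupp.finsetSum_apply, boxExponent_inr, Fintype.sum_prod_type]
    have e3 : (∑ p, M p • boxExponent p = pairExponent L L -
        pairExponent (fun i => w i) fun i => v i) ↔ (∀ i, ∑ j, M (i, j) = L i - w i) ∧
          ∀ i, ∑ j, M (j, i) = L i - v i := by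
      rw [DFunLike.ext_iff, Sum.forall]
      simp only [e1, e2]
      simp [pairExponent]
    rw [e3, mem_contingencyTables]
    constructor
    · rintro ⟨-, h2, h3⟩
      refine ⟨fun i => ?_, fun i => ?_⟩
      · have := h2 i
        rw [← Nat.cast_sum] at this
        omega
      · have := h3 i
        rw [← Nat.cast_sum] at this
        omega
    · rintro ⟨h2, h3⟩
      refine ⟨?_, fun i => ?_, fun i => ?_⟩
      · rw [Fintype.sum_prod_type]
        simp only [h2]
        have : ∑ i, (L i - w i) + ∑ i, (w i : ℕ) = ∑ i, L i := by
          rw [← Finset.sum_add_distrib]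
          exact Finset.sum_congr rfl fun i _ => Nat.sub_add_cancel (h.1 i)
        omega
      · rw [← Nat.cast_sum, h2, Nat.cast_sub (h.1 i)]
      · rw [← Nat.cast_sum, h3, Nat.cast_sub (h.2 i)]
  -- If `x ^ w * y ^ v` does not divide the target monomial, some prescribed margin is negative and
  -- no table exists.
  · rw [Nat.cast_eq_zero, Finset.card_eq_zero, Finset.eq_empty_iff_forall_notMem]
    intro M hM
    obtain ⟨-, h1, h2⟩ := mem_contingencyTables.1 hM
    refine h (hle.2 ⟨fun i => ?_, fun i => ?_⟩)
    · have := h1 i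
      rw [← Nat.cast_sum] at this
      omega
    · have := h2 i
      rw [← Nat.cast_sum] at this
      omega

/-- The virtual character given by the determinantal formula with shape `lam`. -/
def detChar {X : Type*} [Fintype X] [DecidableEq X] (lam : Fin n → ℕ) (g : Perm X) : ℤ :=
  ∑ w : Perm (Fin n), (Perm.sign w : ℤ) *
    permChar (fun i => (lam i : ℤ) - (i : ℕ) + (w i : ℕ)) g

/-- With `L i = lam i + (n - 1 - i)`, strictly decreasing, the exponent `lam i - i + w i` equals `L
i - rev (w i)`. Reindexing by the reversal costs a sign that is squared away. -/
theorem sum_detChar_sq {X : Type*} [Fintype X] [DecidableEq X] (lam : Fin n → ℕ)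
    (hlam : Antitone lam) (hX : ∑ i, lam i = Fintype.card X) :
    ∑ g : Perm X, detChar lam g * detChar lam g = (Fintype.card X).factorial := by
  let L : Fin n → ℕ := fun i => lam i + i.rev
  have hL : Function.Injective L := by
    refine StrictAnti.injective fun i j hij => ?_
    have := hlam hij.le
    have : (j.rev : ℕ) < i.rev := Fin.rev_lt_rev.2 hij
    simp only [L]
    omega
  have hrev : ∑ i : Fin n, (i.rev : ℕ) = ∑ i : Fin n, (i : ℕ) :=
    Equiv.sum_comp Fin.revPerm fun i : Fin n => (i : ℕ)
  have hc : ∀ g : Perm X, detChar lam g = (Perm.sign (Fin.revPerm : Perm (Fin n)) : ℤ) *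
      ∑ w : Perm (Fin n), (Perm.sign w : ℤ) * permChar (fun i => (L i : ℤ) - (w i : ℕ)) g := by
    intro g
    rw [detChar, Finset.mul_sum]
    refine Fintype.sum_equiv (Equiv.mulLeft Fin.revPerm) _ _ fun w => ?_
    have : ∀ i, (lam i : ℤ) - (i : ℕ) + (w i : ℕ) = (L i : ℤ) - (((Fin.revPerm * w : Perm (Fin n)) i : Fin n) : ℕ) := by
      intro i
      simp only [L, Perm.mul_apply, Fin.revPerm_apply, Fin.val_rev]
      omega
    simp only [this, coe_mulLeft, Perm.sign_mul, Units.val_mul]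
    rw [← mul_assoc, ← mul_assoc, ← Units.val_mul, Int.units_mul_self, Units.val_one, one_mul]
  have hs : ((Perm.sign (Fin.revPerm : Perm (Fin n)) : ℤˣ) : ℤ) *
      (Perm.sign (Fin.revPerm : Perm (Fin n)) : ℤ) = 1 := by
    rw [← Units.val_mul, Int.units_mul_self, Units.val_one]
  simp only [hc]
  calc _ = ∑ g : Perm X, ∑ w : Perm (Fin n), ∑ v : Perm (Fin n),
        ((Perm.sign w : ℤ) * (Perm.sign v : ℤ)) *
        (permChar (fun i => (L i : ℤ) - (w i : ℕ)) g *
          permChar (fun i => (L i : ℤ) - (v i : ℕ)) g) := by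
        refine Finset.sum_congr rfl fun g _ => ?_
        rw [mul_mul_mul_comm, hs, one_mul, Finset.sum_mul_sum]
        refine Finset.sum_congr rfl fun w _ => Finset.sum_congr rfl fun v _ => ?_
        ring
    _ = ∑ w : Perm (Fin n), ∑ v : Perm (Fin n), ((Perm.sign w : ℤ) * (Perm.sign v : ℤ)) *
        ∑ g : Perm X, (permChar (fun i => (L i : ℤ) - (w i : ℕ)) g *
          permChar (fun i => (L i : ℤ) - (v i : ℕ)) g) := by
        rw [Finset.sum_comm]
        refine Finset.sum_congr rfl fun w _ => ?_
        rw [Finset.sum_comm]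
        refine Finset.sum_congr rfl fun v _ => ?_
        rw [Finset.mul_sum]
    _ = (Fintype.card X).factorial * 1 := by
        rw [← sum_sign_card_contingencyTables L hL (Fintype.card X)
          (by simp only [L, Finset.sum_add_distrib, hrev, hX]), Finset.mul_sum]
        refine Finset.sum_congr rfl fun w _ => ?_
        rw [Finset.mul_sum]
        refine Finset.sum_congr rfl fun v _ => ?_
        rw [sum_permChar_mul_permChar]
        ring
    _ = _ := mul_one _

end Orthonormality

/-! ### Column-injective colourings of a Young diagram. -/

section Boxes

variable (μ : YoungDiagram)

/-- The row of the box numbered `x`. -/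
def boxRow (x : Fin μ.card) : ℕ := (tableau μ x).1.1

/-- The column of the box numbered `x`. -/
def boxCol (x : Fin μ.card) : ℕ := (tableau μ x).1.2

variable {μ}

theorem box_ext {x y : Fin μ.card} (h₁ : boxRow μ x = boxRow μ y)
    (h₂ : boxCol μ x = boxCol μ y) : x = y :=
  (tableau μ).injective (Subtype.ext (Prod.ext h₁ h₂))

theorem boxRow_lt_colLen (x : Fin μ.card) : boxRow μ x < μ.colLen (boxCol μ x) :=
  YoungDiagram.mem_iff_lt_colLen.1 ((YoungDiagram.mem_cells _).1 (tableau μ x).2)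

theorem exists_box {i j : ℕ} (h : i < μ.colLen j) : ∃ x, boxRow μ x = i ∧ boxCol μ x = j := by
  have hc : (i, j) ∈ μ.cells := (YoungDiagram.mem_cells _).2 (YoungDiagram.mem_iff_lt_colLen.2 h)
  refine ⟨(tableau μ).symm ⟨(i, j), hc⟩, ?_, ?_⟩ <;> simp [boxRow, boxCol]

theorem card_boxRow_eq (i : ℕ) : Fintype.card {x // boxRow μ x = i} = μ.rowLen i := by
  rw [YoungDiagram.rowLen_eq_card, ← Fintype.card_coe]
  refine Fintype.card_congr (((tableau μ).subtypeEquiv fun x => Iff.rfl).trans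
    ((Equiv.subtypeSubtypeEquivSubtypeInter (fun c => c ∈ μ.cells) fun c => c.1 = i).trans
      (Equiv.subtypeEquivRight fun c => ?_)))
  rw [YoungDiagram.mem_row_iff, YoungDiagram.mem_cells]

/-- The row of a box, as an element of `Fin (ℓ(μ))`. -/
def boxRowFin (μ : YoungDiagram) (x : Fin μ.card) : Fin (μ.colLen 0) :=
  ⟨boxRow μ x, (boxRow_lt_colLen x).trans_le (μ.colLen_anti 0 _ (Nat.zero_le _))⟩

theorem card_boxRowFin_eq (i : Fin (μ.colLen 0)) :
    Fintype.card {x // boxRowFin μ x = i} = μ.rowLen i := by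
  rw [← card_boxRow_eq]
  exact Fintype.card_congr (Equiv.subtypeEquivRight fun x => Fin.ext_iff)

theorem sum_rowLen (μ : YoungDiagram) : ∑ i : Fin (μ.colLen 0), μ.rowLen i = μ.card := by
  simp_rw [← card_boxRowFin_eq]
  rw [← Fintype.card_sigma, Fintype.card_congr (Equiv.sigmaFiberEquiv (boxRowFin μ)),
    Fintype.card_fin]

/-- The colouring `f` is injective on the columns of the tableau. -/
def ColInjective {C : Type*} (f : Fin μ.card → C) : Prop :=
  ∀ x y, boxCol μ x = boxCol μ y → f x = f y → x = y

/-- Column `j` contains at most `min k (colLen j)` boxes of colour below `k`, and the row colouring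
attains this bound. Summed over columns it says that the shape dominates the content. -/
theorem ColInjective.card_col_lt_le {f : Fin μ.card → ℕ} (hf : ColInjective f) (j k : ℕ) :
    (Finset.univ.filter fun x => f x < k ∧ boxCol μ x = j).card ≤
      (Finset.univ.filter fun x => boxRow μ x < k ∧ boxCol μ x = j).card := by
  by_cases h : k ≤ μ.colLen j
  · calc _ ≤ (Finset.range k).card := by
          refine Finset.card_le_card_of_injOn f ?_ ?_
          · intro x hx
            simp only [Finset.coe_filter, Finset.mem_univ, true_and, Set.mem_ofPred_eq] at hx
            simpa using hx.1
          · intro x hx y hy hxy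
            simp only [Finset.coe_filter, Finset.mem_univ, true_and, Set.mem_ofPred_eq] at hx hy
            exact hf x y (hx.2.trans hy.2.symm) hxy
      _ ≤ _ := by
          refine Finset.card_le_card_of_surjOn (boxRow μ) ?_
          intro i hi
          obtain ⟨x, hx, hx'⟩ := exists_box (lt_of_lt_of_le (Finset.mem_range.1 hi) h)
          have := Finset.mem_range.1 hi
          refine ⟨x, ?_, hx⟩
          simp [hx, hx', this]
  · refine Finset.card_le_card fun x hx => ?_
    simp only [Finset.mem_filter, Finset.mem_univ, true_and] at hx ⊢
    have := boxRow_lt_colLen x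
    rw [hx.2] at this
    exact ⟨by omega, hx.2⟩

theorem card_filter_eq_sum_col (p : Fin μ.card → Prop) [DecidablePred p] :
    (Finset.univ.filter p).card = ∑ j ∈ Finset.univ.image (boxCol μ),
      (Finset.univ.filter fun x => p x ∧ boxCol μ x = j).card := by
  rw [Finset.card_eq_sum_card_fiberwise (f := boxCol μ) (t := Finset.univ.image (boxCol μ))]
  · simp_rw [Finset.filter_filter]
  · intro x _
    simp

theorem ColInjective.card_lt_le {f : Fin μ.card → ℕ} (hf : ColInjective f) (k : ℕ) :
    (Finset.univ.filter fun x => f x < k).card ≤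
      (Finset.univ.filter fun x => boxRow μ x < k).card := by
  rw [card_filter_eq_sum_col, card_filter_eq_sum_col]
  exact Finset.sum_le_sum fun j _ => hf.card_col_lt_le j k

/-- A column-injective colouring with the fibre sizes of the row colouring is obtained from it by
a permutation within the columns. -/
theorem ColInjective.exists_preservesCols {f : Fin μ.card → ℕ} (hf : ColInjective f)
    (h : ∀ k, (Finset.univ.filter fun x => f x < k).card =
      (Finset.univ.filter fun x => boxRow μ x < k).card) :
    ∃ q : Perm (Fin μ.card), PreservesCols μ q ∧ ∀ x, f x = boxRow μ (q x) := by
  -- Equality of the totals forces equality in each column. With `k` the length of the column of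
  -- `x`, every box of that column has colour below `k`, so the box of the same column in row `f x`
  -- exists and can be taken as `q x`.
  have hlt : ∀ x, f x < μ.colLen (boxCol μ x) := by
    intro x
    have h1 := h (μ.colLen (boxCol μ x))
    rw [card_filter_eq_sum_col, card_filter_eq_sum_col,
      Finset.sum_eq_sum_iff_of_le fun j _ => hf.card_col_lt_le j _] at h1
    have h2 := h1 (boxCol μ x) (by simp)
    have h3 : (Finset.univ.filter fun y => boxRow μ y < μ.colLen (boxCol μ x) ∧
        boxCol μ y = boxCol μ x) = Finset.univ.filter fun y => boxCol μ y = boxCol μ x := by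
      refine Finset.filter_congr fun y _ => ⟨fun hy => hy.2, fun hy => ⟨?_, hy⟩⟩
      rw [← hy]
      exact boxRow_lt_colLen y
    rw [h3] at h2
    have h4 := Finset.eq_of_subset_of_card_le
      (s := Finset.univ.filter fun y => f y < μ.colLen (boxCol μ x) ∧ boxCol μ y = boxCol μ x)
      (t := Finset.univ.filter fun y => boxCol μ y = boxCol μ x)
      (fun y hy => by simp only [Finset.mem_filter, Finset.mem_univ, true_and] at hy ⊢; exact hy.2)
      h2.ge
    have h5 : x ∈ Finset.univ.filter fun y => boxCol μ y = boxCol μ x := by simp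
    rw [← h4] at h5
    exact (Finset.mem_filter.1 h5).2.1
  choose q hq₁ hq₂ using fun x => exists_box (hlt x)
  have hinj : Function.Injective q := fun x y hxy => by
    refine hf x y ?_ ?_
    · rw [← hq₂ x, ← hq₂ y, hxy]
    · rw [← hq₁ x, ← hq₁ y, hxy]
  refine ⟨Equiv.ofBijective q (Finite.injective_iff_bijective.1 hinj), fun x => ?_, fun x => ?_⟩
  · exact hq₂ x
  · exact (hq₁ x).symm

theorem card_val_lt_eq_sum {X : Type*} [Fintype X] {n : ℕ} (f : X → Fin n) (k : ℕ) :
    (Finset.univ.filter fun x => (f x : ℕ) < k).card =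
      ∑ i ∈ Finset.univ.filter (fun i : Fin n => (i : ℕ) < k), Fintype.card {x // f x = i} := by
  rw [Finset.card_eq_sum_card_fiberwise (f := f) (t := Finset.univ.filter fun i : Fin n => (i : ℕ) < k)]
  · refine Finset.sum_congr rfl fun i hi => ?_
    rw [Fintype.card_subtype, Finset.filter_filter]
    congr 1
    refine Finset.filter_congr fun x _ => ⟨fun h => h.2, fun h => ⟨?_, h⟩⟩
    rw [h]
    exact (Finset.mem_filter.1 hi).2
  · intro x hx
    simpa using hx

theorem ColInjective.exists_preservesCols_of_card {f : Fin μ.card → Fin (μ.colLen 0)}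
    (hf : ColInjective f) (h : ∀ i, Fintype.card {x // f x = i} = μ.rowLen i) :
    ∃ q : Perm (Fin μ.card), PreservesCols μ q ∧ f = boxRowFin μ ∘ q := by
  have hf' : ColInjective fun x => (f x : ℕ) := fun x y h₁ h₂ => hf x y h₁ (Fin.ext h₂)
  obtain ⟨q, hq, hfq⟩ := hf'.exists_preservesCols fun k => by
    rw [card_val_lt_eq_sum]
    simp_rw [h, ← card_boxRowFin_eq]
    rw [← card_val_lt_eq_sum]
    rfl
  exact ⟨q, hq, funext fun x => Fin.ext (hfq x)⟩

/-- The compositions in the determinantal formula other than the shape itself are not the fibre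
sizes of a column-injective colouring. -/
theorem ColInjective.perm_eq_one {f : Fin μ.card → Fin (μ.colLen 0)} (hf : ColInjective f)
    (w : Perm (Fin (μ.colLen 0)))
    (h : ∀ i, (Fintype.card {x // f x = i} : ℤ) = (μ.rowLen i : ℤ) - (i : ℕ) + (w i : ℕ)) :
    w = 1 := by
  have hf' : ColInjective fun x => (f x : ℕ) := fun x y h₁ h₂ => hf x y h₁ (Fin.ext h₂)
  -- If `w` fixes everything below `k`, dominance for the first `k + 1` rows reduces to `w k ≤ k`.
  -- If `w k < k`, then `w` fixes `w k`, and injectivity gives `w k = k`.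
  have key : ∀ m : ℕ, ∀ k : Fin (μ.colLen 0), (k : ℕ) = m → w k = k := by
    intro m
    induction m using Nat.strong_induction_on with
    | _ m ih =>
      rintro k rfl
      have h1 := hf'.card_lt_le (k + 1)
      have h2 := card_val_lt_eq_sum (boxRowFin μ) (k + 1)
      change (Finset.univ.filter fun x => boxRow μ x < k + 1).card = _ at h2
      rw [h2, card_val_lt_eq_sum] at h1
      simp_rw [card_boxRowFin_eq] at h1
      have h3 : ∑ i ∈ Finset.univ.filter (fun i : Fin (μ.colLen 0) => (i : ℕ) < k + 1), ((w i : ℤ) - (i : ℕ)) ≤ 0 := by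
        have : ∀ i, ((w i : ℤ) - (i : ℕ)) =
            (Fintype.card {x // f x = i} : ℤ) - (μ.rowLen i : ℤ) := by
          intro i; rw [h]; ring
        simp_rw [this]
        rw [Finset.sum_sub_distrib, sub_nonpos]
        exact_mod_cast h1
      rw [Finset.sum_eq_single k] at h3
      · rcases lt_or_eq_of_le (show (w k : ℕ) ≤ k by omega) with hlt | heq
        · have h4 := ih _ hlt (w k) rfl
          exact w.injective h4
        · exact Fin.ext heq
      · intro i hi hik
        have h5 : (i : ℕ) < k + 1 := (Finset.mem_filter.1 hi).2
        have h6 : (i : ℕ) ≠ k := fun h => hik (Fin.ext h)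
        rw [ih i (by omega) i rfl, sub_self]
      · intro hk
        simp at hk
  ext k
  rw [key k k rfl, Perm.one_apply]

end Boxes

/-! ### Characters of left ideals generated by quasi-idempotents. -/

section QuasiIdempotent

variable {G : Type*} [Group G] [Fintype G]

theorem coeff_mul_eq_sum (x y : MonoidAlgebra ℂ G) (k : G) :
    (x * y).coeff k = ∑ g, x.coeff g * y.coeff (g⁻¹ * k) := by
  classical
  induction x using MonoidAlgebra.induction_linear with
  | zero => simp
  | add x x' h h' => simp [add_mul, h, h', Finset.sum_add_distrib]
  | single g r =>
    rw [MonoidAlgebra.coeff_single_mul_apply, Finset.sum_eq_single g]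
    · simp
    · intro b _ hb
      simp [hb.symm]
    · simp

theorem coeff_mul_eq_sum' (x y : MonoidAlgebra ℂ G) (k : G) :
    (x * y).coeff k = ∑ g, x.coeff (k * g⁻¹) * y.coeff g := by
  rw [coeff_mul_eq_sum]
  refine Fintype.sum_equiv ((Equiv.inv G).trans (Equiv.mulRight k)) _ _ fun g => ?_
  simp

theorem coeff_mul_comm_one (x y : MonoidAlgebra ℂ G) :
    (x * y).coeff 1 = (y * x).coeff 1 := by
  rw [coeff_mul_eq_sum, coeff_mul_eq_sum']
  refine Finset.sum_congr rfl fun g _ => ?_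
  rw [mul_one, one_mul, mul_comm]

theorem trace_monoidAlgebra (f : MonoidAlgebra ℂ G →ₗ[ℂ] MonoidAlgebra ℂ G) :
    LinearMap.trace ℂ _ f = ∑ h, (f (MonoidAlgebra.of ℂ G h)).coeff h := by
  classical
  rw [LinearMap.trace_eq_matrix_trace ℂ (MonoidAlgebra.basis G ℂ)]
  refine Finset.sum_congr rfl fun h _ => ?_
  rw [Matrix.diag_apply, LinearMap.toMatrix_apply]
  rfl

variable {c : MonoidAlgebra ℂ G} {κ : ℂ}

/-- If `κ = 0`, right multiplication by `c` is nilpotent and has trace `0`; but its trace is `|G| *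
c.coeff 1 = |G|`. -/
theorem quasiIdempotent_ne_zero (hc : c * c = κ • c) (h1 : c.coeff 1 = 1) : κ ≠ 0 := by
  rintro rfl
  have hnil : IsNilpotent (LinearMap.mulRight ℂ c) := by
    refine ⟨2, ?_⟩
    refine LinearMap.ext fun x => ?_
    rw [pow_two, Module.End.mul_apply, LinearMap.mulRight_apply, LinearMap.mulRight_apply,
      mul_assoc, hc, zero_smul, mul_zero, LinearMap.zero_apply]
  have htr := (LinearMap.isNilpotent_trace_of_isNilpotent hnil).eq_zero
  rw [trace_monoidAlgebra] at htr
  simp [h1] at htr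

/-- The character of the left ideal generated by a quasi-idempotent. -/
theorem trace_span_quasiIdempotent (hc : c * c = κ • c) (hκ : κ ≠ 0) (g : G) :
    LinearMap.trace ℂ (Ideal.span {c} : Ideal (MonoidAlgebra ℂ G))
      (Representation.ofModule' (Ideal.span {c} : Ideal (MonoidAlgebra ℂ G)) g) =
      κ⁻¹ * ∑ h, c.coeff (h⁻¹ * g⁻¹ * h) := by
  let I : Ideal (MonoidAlgebra ℂ G) := Ideal.span {c}
  let incl : I →ₗ[ℂ] MonoidAlgebra ℂ G := I.subtype.restrictScalars ℂ
  -- The map `x ↦ κ⁻¹ x c` is a projection onto the ideal, so the trace of `g` on the ideal is the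
  -- trace of `x ↦ κ⁻¹ g x c` on the whole group algebra.
  let proj : MonoidAlgebra ℂ G →ₗ[ℂ] I :=
    { toFun := fun x => ⟨(κ⁻¹ • x) * c, Ideal.mem_span_singleton'.2 ⟨_, rfl⟩⟩
      map_add' := fun x y => Subtype.ext (by simp [add_mul])
      map_smul' := fun r x => Subtype.ext (by simp [smul_smul, mul_comm]) }
  have hfac : Representation.ofModule' (k := ℂ) (G := G) I g =
      proj ∘ₗ (LinearMap.mulLeft ℂ (MonoidAlgebra.of ℂ G g) ∘ₗ incl) := by
    ext1 x
    apply Subtype.ext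
    obtain ⟨y, hy⟩ := Ideal.mem_span_singleton'.1 x.2
    have h1 : ((Representation.ofModule' (k := ℂ) (G := G) I g x : I) : MonoidAlgebra ℂ G) =
        MonoidAlgebra.of ℂ G g * x.1 := by
      simp [Representation.ofModule']
    rw [h1]
    simp only [proj, incl, LinearMap.comp_apply, LinearMap.coe_mk, AddHom.coe_mk,
      LinearMap.mulLeft_apply, LinearMap.restrictScalars_apply, Submodule.subtype_apply]
    rw [← hy, smul_mul_assoc, mul_assoc, mul_assoc, hc, mul_smul_comm, mul_smul_comm, smul_smul,
      inv_mul_cancel₀ hκ, one_smul]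
  change LinearMap.trace ℂ I (Representation.ofModule' (k := ℂ) (G := G) I g) = _
  rw [hfac, LinearMap.trace_comp_comm', trace_monoidAlgebra, Finset.mul_sum]
  refine Finset.sum_congr rfl fun h _ => ?_
  simp only [proj, incl, LinearMap.comp_apply, LinearMap.coe_mk, AddHom.coe_mk,
      LinearMap.mulLeft_apply, LinearMap.restrictScalars_apply, Submodule.subtype_apply]
  rw [smul_mul_assoc, mul_smul_comm, MonoidAlgebra.coeff_smul, Finsupp.smul_apply, smul_eq_mul,
    MonoidAlgebra.of_apply, MonoidAlgebra.of_apply, MonoidAlgebra.coeff_single_mul_apply,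
    MonoidAlgebra.coeff_single_mul_apply, one_mul, one_mul, mul_assoc]

/-- Pairing a class function with the character of a quasi-idempotent. -/
theorem sum_mul_quasiCharacter (F : G → ℂ) (hF : ∀ g h, F (h * g * h⁻¹) = F g)
    (hF' : ∀ g, F g⁻¹ = F g) :
    ∑ g, F g * (κ⁻¹ * ∑ h, c.coeff (h⁻¹ * g⁻¹ * h)) =
      κ⁻¹ * (Fintype.card G * ∑ g, c.coeff g * F g) := by
  calc _ = κ⁻¹ * ∑ h : G, ∑ g, F g * c.coeff (h⁻¹ * g⁻¹ * h) := by
        rw [Finset.sum_comm, Finset.mul_sum]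
        refine Finset.sum_congr rfl fun g _ => ?_
        rw [← Finset.mul_sum]; ring
    _ = κ⁻¹ * ∑ h : G, ∑ g, c.coeff g * F g := by
        congr 1
        refine Finset.sum_congr rfl fun h _ => ?_
        refine Fintype.sum_equiv ((Equiv.inv G).trans (MulAut.conj h⁻¹).toEquiv) _ _ fun g => ?_
        have : F (h⁻¹ * g⁻¹ * h) = F g := by
          rw [← hF' g]
          simpa using hF g⁻¹ h⁻¹
        simp [this, mul_comm]
    _ = _ := by
        rw [Finset.sum_const, Finset.card_univ, nsmul_eq_mul]

/-- The pairing of a primitive quasi-idempotent with the character of its left ideal. -/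
theorem sum_coeff_mul_quasiCharacter (hc : c * c = κ • c) (hκ : κ ≠ 0) (h1 : c.coeff 1 = 1)
    (hprim : ∀ x, ∃ z : ℂ, c * x * c = z • c) :
    ∑ g, c.coeff g * (κ⁻¹ * ∑ h, c.coeff (h⁻¹ * g⁻¹ * h)) = κ := by
  -- The left side is the coefficient at `h` of `c h c = z c`, that is `z * c.coeff h`. The
  -- coefficient at `1` gives `z = (c * c).coeff h⁻¹ = κ * c.coeff h⁻¹`.
  have h2 : ∀ h, ∑ g, c.coeff g * c.coeff (h⁻¹ * g⁻¹ * h) =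
      κ * (c.coeff h⁻¹ * c.coeff h) := by
    intro h
    have e1 : (c * (MonoidAlgebra.of ℂ G h * c)).coeff h =
        ∑ g, c.coeff g * c.coeff (h⁻¹ * g⁻¹ * h) := by
      rw [coeff_mul_eq_sum]
      refine Finset.sum_congr rfl fun g _ => ?_
      rw [MonoidAlgebra.of_apply, MonoidAlgebra.coeff_single_mul_apply, one_mul, mul_assoc]
    have e2 : (c * (MonoidAlgebra.of ℂ G h * c)).coeff 1 = (c * c).coeff h⁻¹ := by
      rw [coeff_mul_eq_sum, coeff_mul_eq_sum']
      refine Finset.sum_congr rfl fun g _ => ?_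
      rw [MonoidAlgebra.of_apply, MonoidAlgebra.coeff_single_mul_apply, one_mul, mul_one, mul_comm]
    obtain ⟨z, hz⟩ := hprim (MonoidAlgebra.of ℂ G h)
    rw [mul_assoc] at hz
    rw [← e1, hz]
    rw [hz, hc] at e2
    simp only [MonoidAlgebra.coeff_smul, Finsupp.smul_apply, smul_eq_mul, h1, mul_one] at e2 ⊢
    rw [e2, mul_assoc]
  have h3 : ∑ h, c.coeff h⁻¹ * c.coeff h = κ := by
    have := coeff_mul_eq_sum' c c 1
    simp only [one_mul] at this
    rw [← this, hc]
    simp [h1]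
  calc _ = κ⁻¹ * ∑ h, ∑ g, c.coeff g * c.coeff (h⁻¹ * g⁻¹ * h) := by
        rw [Finset.sum_comm, Finset.mul_sum]
        refine Finset.sum_congr rfl fun g _ => ?_
        rw [← Finset.mul_sum]; ring
    _ = κ := by
        simp_rw [h2]
        rw [← Finset.mul_sum, h3, inv_mul_cancel_left₀ hκ]

end QuasiIdempotent

/-! ### The Young symmetrizer and the norm of its character. -/

section YoungSymmetrizer

open Classical in
/-- The sum of the row-preserving permutations. -/
def rowSum (μ : YoungDiagram) : MonoidAlgebra ℂ (Perm (Fin μ.card)) :=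
  ∑ p : Perm (Fin μ.card) with PreservesRows μ p, MonoidAlgebra.of ℂ _ p

open Classical in
/-- The signed sum of the column-preserving permutations. -/
def colSum (μ : YoungDiagram) : MonoidAlgebra ℂ (Perm (Fin μ.card)) :=
  ∑ q : Perm (Fin μ.card) with PreservesCols μ q, ((Perm.sign q : ℤ) : ℂ) • MonoidAlgebra.of ℂ _ q

variable {μ : YoungDiagram}

theorem youngSymmetrizer_eq : youngSymmetrizer μ = rowSum μ * colSum μ := rfl

theorem preservesRows_iff {p : Perm (Fin μ.card)} :
    PreservesRows μ p ↔ ∀ x, boxRow μ (p x) = boxRow μ x := Iff.rfl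

theorem preservesCols_iff {q : Perm (Fin μ.card)} :
    PreservesCols μ q ↔ ∀ x, boxCol μ (q x) = boxCol μ x := Iff.rfl

theorem PreservesRows.mul {p p' : Perm (Fin μ.card)} (h : PreservesRows μ p)
    (h' : PreservesRows μ p') : PreservesRows μ (p * p') :=
  fun x => (h (p' x)).trans (h' x)

theorem PreservesRows.inv {p : Perm (Fin μ.card)} (h : PreservesRows μ p) :
    PreservesRows μ p⁻¹ := fun x => by
  have := h (p⁻¹ x)
  rw [show p (p⁻¹ x) = x from p.apply_symm_apply x] at this
  exact this.symm

theorem PreservesCols.mul {p p' : Perm (Fin μ.card)} (h : PreservesCols μ p)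
    (h' : PreservesCols μ p') : PreservesCols μ (p * p') :=
  fun x => (h (p' x)).trans (h' x)

theorem PreservesCols.inv {p : Perm (Fin μ.card)} (h : PreservesCols μ p) :
    PreservesCols μ p⁻¹ := fun x => by
  have := h (p⁻¹ x)
  rw [show p (p⁻¹ x) = x from p.apply_symm_apply x] at this
  exact this.symm

theorem preservesRows_mul_right {p : Perm (Fin μ.card)} (h : PreservesRows μ p)
    (p' : Perm (Fin μ.card)) : PreservesRows μ (p' * p) ↔ PreservesRows μ p' :=
  ⟨fun h' => by simpa using h'.mul h.inv, fun h' => h'.mul h⟩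

theorem preservesCols_mul_left {q : Perm (Fin μ.card)} (h : PreservesCols μ q)
    (q' : Perm (Fin μ.card)) : PreservesCols μ (q * q') ↔ PreservesCols μ q' :=
  ⟨fun h' => by simpa using h.inv.mul h', fun h' => h.mul h'⟩

theorem preservesCols_mul_right {q : Perm (Fin μ.card)} (h : PreservesCols μ q)
    (q' : Perm (Fin μ.card)) : PreservesCols μ (q' * q) ↔ PreservesCols μ q' :=
  ⟨fun h' => by simpa using h'.mul h.inv, fun h' => h'.mul h⟩

theorem eq_one_of_preserves {p : Perm (Fin μ.card)} (h : PreservesRows μ p)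
    (h' : PreservesCols μ p) : p = 1 :=
  Equiv.ext fun x => box_ext (h x) (h' x)

theorem rowSum_mul_of {p : Perm (Fin μ.card)} (h : PreservesRows μ p) :
    rowSum μ * MonoidAlgebra.of ℂ _ p = rowSum μ := by
  classical
  rw [rowSum, Finset.sum_mul, Finset.sum_filter, Finset.sum_filter]
  refine Fintype.sum_equiv (Equiv.mulRight p) _ _ fun p' => ?_
  simp only [coe_mulRight, preservesRows_mul_right h, map_mul]

theorem of_mul_colSum {q : Perm (Fin μ.card)} (h : PreservesCols μ q) :
    MonoidAlgebra.of ℂ _ q * colSum μ = ((Perm.sign q : ℤ) : ℂ) • colSum μ := by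
  classical
  rw [colSum, Finset.mul_sum, Finset.smul_sum, Finset.sum_filter, Finset.sum_filter]
  refine Fintype.sum_equiv (Equiv.mulLeft q) _ _ fun q' => ?_
  simp only [coe_mulLeft, preservesCols_mul_left h, map_mul, mul_smul_comm, smul_smul,
    Units.val_mul, Int.cast_mul]
  rw [← mul_assoc, ← Int.cast_mul, ← Units.val_mul, Int.units_mul_self, Units.val_one,
    Int.cast_one, one_mul]

theorem preservesRows_swap {x y : Fin μ.card} (h : boxRow μ x = boxRow μ y) :
    PreservesRows μ (swap x y) := by
  rw [preservesRows_iff]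
  exact apply_swap_eq_self h

theorem preservesCols_swap {x y : Fin μ.card} (h : boxCol μ x = boxCol μ y) :
    PreservesCols μ (swap x y) := by
  rw [preservesCols_iff]
  exact apply_swap_eq_self h

theorem card_boxRowFin_comp (g : Perm (Fin μ.card)) (i : Fin (μ.colLen 0)) :
    Fintype.card {x // (boxRowFin μ ∘ g) x = i} = μ.rowLen i := by
  rw [← card_boxRowFin_eq]
  exact Fintype.card_congr (g.subtypeEquiv fun x => Iff.rfl)

/-- Von Neumann's lemma. -/
theorem rowSum_mul_of_mul_colSum (g : Perm (Fin μ.card)) :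
    ∃ z : ℂ, rowSum μ * MonoidAlgebra.of ℂ _ g * colSum μ = z • youngSymmetrizer μ := by
  -- In the column-injective case `g` is a row-preserving times a column-preserving permutation, and
  -- both factors are absorbed. Otherwise two boxes of one column are sent into one row, and
  -- absorbing the corresponding transpositions on both sides shows that the element equals its
  -- negative.
  by_cases hg : ColInjective (boxRowFin μ ∘ g)
  · obtain ⟨q, hq, hgq⟩ := hg.exists_preservesCols_of_card (card_boxRowFin_comp g)
    have hp : PreservesRows μ (g * q⁻¹) := by
      intro x
      have := congrFun hgq (q⁻¹ x)
      simp only [Function.comp_apply, show q (q⁻¹ x) = x from q.apply_symm_apply x] at this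
      exact congrArg Fin.val this
    refine ⟨((Perm.sign q : ℤ) : ℂ), ?_⟩
    rw [← inv_mul_cancel_right g q, map_mul, ← mul_assoc, rowSum_mul_of hp, mul_assoc,
      of_mul_colSum hq, mul_smul_comm, youngSymmetrizer_eq]
  · simp only [ColInjective, not_forall] at hg
    obtain ⟨x, y, hcol, hrow, hxy⟩ := hg
    have ht : PreservesRows μ (swap (g x) (g y)) := preservesRows_swap (congrArg Fin.val hrow)
    have hs : PreservesCols μ (swap x y) := preservesCols_swap hcol
    have h1 : swap (g x) (g y) * g = g * swap x y := by
      rw [Equiv.mul_swap_eq_swap_mul]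
    refine ⟨0, ?_⟩
    rw [zero_smul]
    have h2 : rowSum μ * MonoidAlgebra.of ℂ _ g * colSum μ =
        -(rowSum μ * MonoidAlgebra.of ℂ _ g * colSum μ) := by
      conv_lhs => rw [← rowSum_mul_of ht, mul_assoc (rowSum μ), ← map_mul, h1, map_mul,
        ← mul_assoc, mul_assoc, of_mul_colSum hs, Perm.sign_swap hxy]
      simp
    rw [eq_neg_iff_add_eq_zero, ← two_smul ℂ] at h2
    rw [← inv_smul_smul₀ (two_ne_zero (α := ℂ)) (_ * _ * _), h2, smul_zero]

theorem rowSum_mul_mul_colSum (x : MonoidAlgebra ℂ (Perm (Fin μ.card))) :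
    ∃ z : ℂ, rowSum μ * x * colSum μ = z • youngSymmetrizer μ := by
  induction x using MonoidAlgebra.induction_linear with
  | zero => exact ⟨0, by simp⟩
  | add x y hx hy =>
    obtain ⟨a, ha⟩ := hx
    obtain ⟨b, hb⟩ := hy
    exact ⟨a + b, by rw [mul_add, add_mul, ha, hb, add_smul]⟩
  | single g r =>
    obtain ⟨z, hz⟩ := rowSum_mul_of_mul_colSum g
    refine ⟨r * z, ?_⟩
    have : MonoidAlgebra.single g r = r • MonoidAlgebra.of ℂ _ g := by simp
    rw [this, mul_smul_comm, smul_mul_assoc, hz, smul_smul]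

/-- Primitivity: write `c x c` as `rowSum * (colSum * x * rowSum) * colSum` and apply the linear
extension of von Neumann's lemma. -/
theorem youngSymmetrizer_mul_mul (x : MonoidAlgebra ℂ (Perm (Fin μ.card))) :
    ∃ z : ℂ, youngSymmetrizer μ * x * youngSymmetrizer μ = z • youngSymmetrizer μ := by
  obtain ⟨z, hz⟩ := rowSum_mul_mul_colSum (colSum μ * x * rowSum μ)
  refine ⟨z, hz ▸ ?_⟩
  simp only [youngSymmetrizer_eq, mul_assoc]

open Classical in
theorem coeff_youngSymmetrizer (g : Perm (Fin μ.card)) :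
    (youngSymmetrizer μ).coeff g = ∑ p : Perm (Fin μ.card) with PreservesRows μ p,
      ∑ q : Perm (Fin μ.card) with PreservesCols μ q,
        if p * q = g then ((Perm.sign q : ℤ) : ℂ) else 0 := by
  rw [youngSymmetrizer_eq, rowSum, colSum, Finset.sum_mul_sum, MonoidAlgebra.coeff_sum,
    Finsupp.finsetSum_apply]
  refine Finset.sum_congr rfl fun p _ => ?_
  rw [MonoidAlgebra.coeff_sum, Finsupp.finsetSum_apply]
  refine Finset.sum_congr rfl fun q _ => ?_
  rw [mul_smul_comm, ← map_mul, MonoidAlgebra.coeff_smul, Finsupp.smul_apply,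
    MonoidAlgebra.of_apply, MonoidAlgebra.coeff_single, Finsupp.single_apply]
  simp

open Classical in
/-- Summing a function against the Young symmetrizer. -/
theorem sum_coeff_youngSymmetrizer_mul (F : Perm (Fin μ.card) → ℂ) :
    ∑ g, (youngSymmetrizer μ).coeff g * F g =
      ∑ p : Perm (Fin μ.card) with PreservesRows μ p,
        ∑ q : Perm (Fin μ.card) with PreservesCols μ q, ((Perm.sign q : ℤ) : ℂ) * F (p * q) := by
  simp_rw [coeff_youngSymmetrizer, Finset.sum_mul]
  rw [Finset.sum_comm]
  refine Finset.sum_congr rfl fun p _ => ?_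
  rw [Finset.sum_comm]
  refine Finset.sum_congr rfl fun q _ => ?_
  simp

/-- A permutation preserving both rows and columns is trivial, so `p * q = 1` only for `p = q = 1`.
-/
theorem coeff_youngSymmetrizer_one : (youngSymmetrizer μ).coeff 1 = 1 := by
  classical
  rw [coeff_youngSymmetrizer, Finset.sum_eq_single 1, Finset.sum_eq_single 1]
  · simp
  · intro q _ hq
    rw [if_neg (by simpa using hq)]
  · intro h
    exact absurd (Finset.mem_filter.2 ⟨Finset.mem_univ _, fun _ => rfl⟩) h
  · intro p hp hp1
    refine Finset.sum_eq_zero fun q hq => if_neg fun hpq => hp1 ?_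
    have h1 : p = q⁻¹ := eq_inv_of_mul_eq_one_left hpq
    refine eq_one_of_preserves (Finset.mem_filter.1 hp).2 ?_
    rw [h1]
    exact PreservesCols.inv (Finset.mem_filter.1 hq).2
  · intro h
    exact absurd (Finset.mem_filter.2 ⟨Finset.mem_univ _, fun _ => rfl⟩) h

theorem conj_coeff_youngSymmetrizer (g : Perm (Fin μ.card)) :
    (starRingEnd ℂ) ((youngSymmetrizer μ).coeff g) = (youngSymmetrizer μ).coeff g := by
  classical
  rw [coeff_youngSymmetrizer, map_sum]
  refine Finset.sum_congr rfl fun p _ => ?_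
  rw [map_sum]
  refine Finset.sum_congr rfl fun q _ => ?_
  split_ifs <;> simp

/-- The scalar `κ` with `c * c = κ • c` for the Young symmetrizer `c`. -/
def youngScalar (μ : YoungDiagram) : ℂ :=
  (youngSymmetrizer μ * youngSymmetrizer μ).coeff 1

theorem youngSymmetrizer_mul_self :
    youngSymmetrizer μ * youngSymmetrizer μ = youngScalar μ • youngSymmetrizer μ := by
  obtain ⟨z, hz⟩ := youngSymmetrizer_mul_mul (μ := μ) 1
  rw [mul_one] at hz
  rw [youngScalar, hz, MonoidAlgebra.coeff_smul, Finsupp.smul_apply, coeff_youngSymmetrizer_one,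
    smul_eq_mul, mul_one]

theorem youngScalar_ne_zero : youngScalar μ ≠ 0 :=
  quasiIdempotent_ne_zero youngSymmetrizer_mul_self coeff_youngSymmetrizer_one

theorem conj_youngScalar : (starRingEnd ℂ) (youngScalar μ) = youngScalar μ := by
  rw [youngScalar, coeff_mul_eq_sum, map_sum]
  simp only [map_mul, conj_coeff_youngSymmetrizer]

theorem chi_eq (g : Perm (Fin μ.card)) :
    chi μ g = (youngScalar μ)⁻¹ * ∑ h, (youngSymmetrizer μ).coeff (h⁻¹ * g⁻¹ * h) :=
  trace_span_quasiIdempotent youngSymmetrizer_mul_self youngScalar_ne_zero g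

theorem conj_chi (g : Perm (Fin μ.card)) : (starRingEnd ℂ) (chi μ g) = chi μ g := by
  rw [chi_eq, map_mul, map_inv₀, conj_youngScalar, map_sum]
  simp only [conj_coeff_youngSymmetrizer]

theorem chi_conj (g h : Perm (Fin μ.card)) : chi μ (h * g * h⁻¹) = chi μ g := by
  rw [chi_eq, chi_eq]
  congr 1
  refine Fintype.sum_equiv (Equiv.mulLeft h⁻¹) _ _ fun k => ?_
  congr 1

theorem chi_inv (g : Perm (Fin μ.card)) : chi μ g⁻¹ = chi μ g := by
  obtain ⟨h, hh⟩ := isConj_iff.1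
    (Perm.isConj_iff_cycleType_eq.2 (Perm.cycleType_inv g).symm)
  rw [← hh, chi_conj]

/-- The characters have norm one. -/
theorem sum_chi_mul_chi :
    ∑ g, chi μ g * chi μ g = (μ.card.factorial : ℂ) := by
  have h := sum_mul_quasiCharacter (c := youngSymmetrizer μ) (κ := youngScalar μ) (chi μ)
    chi_conj chi_inv
  simp_rw [← chi_eq] at h
  have h' := sum_coeff_mul_quasiCharacter (youngSymmetrizer_mul_self (μ := μ)) youngScalar_ne_zero
    coeff_youngSymmetrizer_one youngSymmetrizer_mul_mul
  simp_rw [← chi_eq] at h'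
  rw [h, h', mul_comm, mul_assoc, mul_inv_cancel₀ youngScalar_ne_zero, mul_one, Fintype.card_perm,
    Fintype.card_fin]

end YoungSymmetrizer

/-! ### The determinantal formula for the irreducible characters. -/

section JacobiTrudi

theorem permChar_conj {X K : Type*} [Fintype X] [DecidableEq X] [Fintype K] [DecidableEq K]
    (α : K → ℤ) (g h : Perm X) : permChar α (h * g * h⁻¹) = permChar α g := by
  rw [permChar, permChar, Nat.cast_inj]
  refine Finset.card_bij' (fun f _ => f ∘ h) (fun f _ => f ∘ ⇑h⁻¹) ?_ ?_ ?_ ?_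
  · intro f hf
    simp only [fixedColourings, Finset.mem_filter, Finset.mem_univ, true_and] at hf ⊢
    refine ⟨fun k => ?_, ?_⟩
    · rw [← hf.1 k, Nat.cast_inj]
      exact Fintype.card_congr (h.subtypeEquiv fun x => Iff.rfl)
    · conv_rhs => rw [← hf.2]
      ext x
      simp
  · intro f hf
    simp only [fixedColourings, Finset.mem_filter, Finset.mem_univ, true_and] at hf ⊢
    refine ⟨fun k => ?_, ?_⟩
    · rw [← hf.1 k, Nat.cast_inj]
      exact Fintype.card_congr (h⁻¹.subtypeEquiv fun x => Iff.rfl)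
    · conv_rhs => rw [← hf.2]
      ext x
      simp
  · intro f _
    ext x
    simp
  · intro f _
    ext x
    simp

theorem permChar_inv {X K : Type*} [Fintype X] [DecidableEq X] [Fintype K] [DecidableEq K]
    (α : K → ℤ) (g : Perm X) : permChar α g⁻¹ = permChar α g := by
  obtain ⟨h, hh⟩ := isConj_iff.1
    (Perm.isConj_iff_cycleType_eq.2 (Perm.cycleType_inv g).symm)
  rw [← hh, permChar_conj]

/-- The colourings with fibre sizes `α`. -/
def colouringsOfType {X K : Type*} [Fintype X] [DecidableEq X] [Fintype K] [DecidableEq K]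
    (α : K → ℤ) : Finset (X → K) :=
  Finset.univ.filter fun f => ∀ k, (Fintype.card {x // f x = k} : ℤ) = α k

theorem mem_colouringsOfType {X K : Type*} [Fintype X] [DecidableEq X] [Fintype K] [DecidableEq K]
    {α : K → ℤ} {f : X → K} :
    f ∈ colouringsOfType α ↔ ∀ k, (Fintype.card {x // f x = k} : ℤ) = α k := by
  simp [colouringsOfType]

variable {μ : YoungDiagram}

open Classical in
/-- The contribution of a colouring to the pairing of the Young symmetrizer with a permutation
character. -/
def colouringWeight {K : Type*} [DecidableEq K] (f : Fin μ.card → K) : ℂ :=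
  ∑ p : Perm (Fin μ.card) with PreservesRows μ p,
    ∑ q : Perm (Fin μ.card) with PreservesCols μ q,
      if f ∘ ⇑(p * q) = f then ((Perm.sign q : ℤ) : ℂ) else 0

/-- If two boxes of a column share a colour, multiplying `q` by their transposition preserves the
condition and flips the sign, so the terms cancel. -/
theorem colouringWeight_eq_zero {K : Type*} [DecidableEq K] {f : Fin μ.card → K} (hf : ¬ ColInjective f) :
    colouringWeight f = 0 := by
  classical
  simp only [ColInjective, not_forall] at hf
  obtain ⟨x, y, hcol, hfxy, hxy⟩ := hf
  have hs : PreservesCols μ (swap x y) := preservesCols_swap hcol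
  have hfs : f ∘ ⇑(swap x y) = f := funext fun z => apply_swap_eq_self hfxy z
  refine Finset.sum_eq_zero fun p _ => ?_
  rw [← self_eq_neg, Finset.sum_filter, ← Finset.sum_neg_distrib]
  refine Fintype.sum_equiv (Equiv.mulRight (swap x y)) _ _ fun q => ?_
  have h1 : f ∘ ⇑(p * (q * swap x y)) = f ↔ f ∘ ⇑(p * q) = f := by
    rw [← mul_assoc, Perm.coe_mul (p * q), ← Function.comp_assoc]
    constructor
    · intro h
      ext z
      have := congrFun h (swap x y z)
      simp only [Function.comp_apply, swap_apply_self] at this ⊢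
      rw [this]
      exact congrFun hfs z
    · intro h
      rw [h, hfs]
  simp only [coe_mulRight, preservesCols_mul_right hs, h1, Perm.sign_mul, Perm.sign_swap hxy]
  split_ifs <;> simp

theorem sum_coeff_mul_permChar {K : Type*} [Fintype K] [DecidableEq K] (α : K → ℤ) :
    ∑ g, (youngSymmetrizer μ).coeff g * (permChar α g : ℂ) =
      ∑ f ∈ colouringsOfType (X := Fin μ.card) α, colouringWeight f := by
  classical
  rw [sum_coeff_youngSymmetrizer_mul]
  simp only [colouringWeight, colouringsOfType]
  symm
  rw [Finset.sum_comm]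
  refine Finset.sum_congr rfl fun p _ => ?_
  rw [Finset.sum_comm]
  refine Finset.sum_congr rfl fun q _ => ?_
  symm
  rw [permChar, fixedColourings, ← Finset.sum_filter, Finset.filter_filter, Finset.sum_const,
    nsmul_eq_mul, mul_comm]
  simp

theorem sum_coeff_mul_permChar_of_ne_one (w : Perm (Fin (μ.colLen 0))) (hw : w ≠ 1) :
    ∑ g, (youngSymmetrizer μ).coeff g *
      (permChar (fun i : Fin (μ.colLen 0) => (μ.rowLen i : ℤ) - (i : ℕ) + (w i : ℕ)) g : ℂ) = 0 := by
  rw [sum_coeff_mul_permChar]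
  refine Finset.sum_eq_zero fun f hf => colouringWeight_eq_zero fun hinj => hw ?_
  exact hinj.perm_eq_one w (mem_colouringsOfType.1 hf)

open Classical in
theorem coeff_rowSum (g : Perm (Fin μ.card)) :
    (rowSum μ).coeff g = if PreservesRows μ g then 1 else 0 := by
  rw [rowSum, MonoidAlgebra.coeff_sum, Finsupp.finsetSum_apply]
  simp [Finsupp.single_apply]

open Classical in
theorem coeff_colSum_mul (x : MonoidAlgebra ℂ (Perm (Fin μ.card))) (g : Perm (Fin μ.card)) :
    (colSum μ * x).coeff g = ∑ q : Perm (Fin μ.card) with PreservesCols μ q,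
      ((Perm.sign q : ℤ) : ℂ) * x.coeff (q⁻¹ * g) := by
  rw [colSum, Finset.sum_mul, MonoidAlgebra.coeff_sum, Finsupp.finsetSum_apply]
  refine Finset.sum_congr rfl fun q _ => ?_
  rw [smul_mul_assoc, MonoidAlgebra.coeff_smul, Finsupp.smul_apply, MonoidAlgebra.of_apply,
    MonoidAlgebra.coeff_single_mul_apply, one_mul, smul_eq_mul]

open Classical in
theorem coeff_rowSum_mul (x : MonoidAlgebra ℂ (Perm (Fin μ.card))) (g : Perm (Fin μ.card)) :
    (rowSum μ * x).coeff g = ∑ p : Perm (Fin μ.card) with PreservesRows μ p,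
      x.coeff (p⁻¹ * g) := by
  rw [rowSum, Finset.sum_mul, MonoidAlgebra.coeff_sum, Finsupp.finsetSum_apply]
  refine Finset.sum_congr rfl fun q _ => ?_
  rw [MonoidAlgebra.of_apply, MonoidAlgebra.coeff_single_mul_apply, one_mul]

theorem boxRowFin_comp_eq_iff (q₀ g : Perm (Fin μ.card)) :
    (boxRowFin μ ∘ q₀) ∘ g = boxRowFin μ ∘ q₀ ↔ PreservesRows μ (q₀ * g * q₀⁻¹) := by
  rw [preservesRows_iff, funext_iff, ← q₀.symm.forall_congr_right]
  simp [boxRowFin, Fin.ext_iff]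

-- `youngScalar μ` is the coefficient of `1` in `rowSum * colSum * rowSum * colSum`; rotated
-- cyclically, it is the sum of `sign (q₀ * q)` over triples `q₀, p, q` with `q₀ * p * q`
-- row-preserving. This says that `p * (q * q₀)` fixes the colouring `boxRowFin μ ∘ q₀`.
open Classical in
theorem youngScalar_eq_sum : youngScalar μ =
    ∑ q₀ : Perm (Fin μ.card) with PreservesCols μ q₀, colouringWeight (boxRowFin μ ∘ q₀) := by
  rw [youngScalar, youngSymmetrizer_eq, mul_assoc, coeff_mul_comm_one, mul_assoc,
    coeff_colSum_mul]
  refine Finset.sum_congr rfl fun q₀ hq₀ => ?_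
  have hq₀' := (Finset.mem_filter.1 hq₀).2
  rw [mul_assoc, coeff_rowSum_mul, Finset.mul_sum, colouringWeight]
  refine Finset.sum_congr rfl fun p _ => ?_
  rw [coeff_colSum_mul, Finset.mul_sum, Finset.sum_filter, Finset.sum_filter]
  refine Fintype.sum_equiv (Equiv.mulRight q₀) _ _ fun q => ?_
  have h1 : PreservesRows μ (q⁻¹ * (p⁻¹ * (q₀⁻¹ * 1))) ↔
      PreservesRows μ (q₀ * (p * (q * q₀)) * q₀⁻¹) := by
    have : q⁻¹ * (p⁻¹ * (q₀⁻¹ * 1)) = (q₀ * (p * (q * q₀)) * q₀⁻¹)⁻¹ := by group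
    rw [this]
    exact ⟨fun h => by simpa using h.inv, fun h => h.inv⟩
  simp only [coe_mulRight, preservesCols_mul_right hq₀', coeff_rowSum, boxRowFin_comp_eq_iff, h1,
    Perm.sign_mul, Units.val_mul, Int.cast_mul]
  split_ifs
  · ring
  · simp
  · rfl

/-- Only column-injective colourings contribute, and those of content `μ` are the row colouring
composed with column-preserving permutations. Both sides are the same sum of weights, so
`youngScalar μ` need not be evaluated. -/
theorem sum_coeff_mul_permChar_one :
    ∑ g, (youngSymmetrizer μ).coeff g *
      (permChar (fun i : Fin (μ.colLen 0) => (μ.rowLen i : ℤ)) g : ℂ) = youngScalar μ := by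
  classical
  rw [sum_coeff_mul_permChar, youngScalar_eq_sum]
  symm
  refine Finset.sum_bij_ne_zero (fun q _ _ => boxRowFin μ ∘ q) ?_ ?_ ?_ ?_
  · intro q _ _
    rw [mem_colouringsOfType]
    intro i
    rw [card_boxRowFin_comp]
  · intro q hq _ q' hq' _ h
    ext x : 1
    refine box_ext (congrArg Fin.val (congrFun h x)) ?_
    exact ((Finset.mem_filter.1 hq).2 x).trans ((Finset.mem_filter.1 hq').2 x).symm
  · intro f hf hne
    have hinj : ColInjective f := by
      by_contra h
      exact hne (colouringWeight_eq_zero h)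
    obtain ⟨q, hq, rfl⟩ := hinj.exists_preservesCols_of_card fun i => by
      exact_mod_cast mem_colouringsOfType.1 hf i
    exact ⟨q, Finset.mem_filter.2 ⟨Finset.mem_univ _, hq⟩, hne, rfl⟩
  · intro q _ _
    rfl

theorem sum_permChar_mul_chi (w : Perm (Fin (μ.colLen 0))) :
    ∑ g, (permChar (fun i : Fin (μ.colLen 0) => (μ.rowLen i : ℤ) - (i : ℕ) + (w i : ℕ)) g : ℂ) * chi μ g =
      if w = 1 then (μ.card.factorial : ℂ) else 0 := by
  simp_rw [chi_eq]
  rw [sum_mul_quasiCharacter _ (fun g h => by rw [permChar_conj])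
    (fun g => by rw [permChar_inv])]
  split_ifs with hw
  · subst hw
    simp only [Perm.one_apply, sub_add_cancel]
    rw [sum_coeff_mul_permChar_one, mul_comm, mul_assoc, mul_inv_cancel₀ youngScalar_ne_zero,
      mul_one, Fintype.card_perm, Fintype.card_fin]
  · rw [sum_coeff_mul_permChar_of_ne_one w hw, mul_zero, mul_zero]

theorem sum_detChar_mul_chi :
    ∑ g, (detChar (fun i : Fin (μ.colLen 0) => μ.rowLen i) g : ℂ) * chi μ g =
      (μ.card.factorial : ℂ) := by
  simp only [detChar, Int.cast_sum, Int.cast_mul, Finset.sum_mul]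
  rw [Finset.sum_comm]
  simp_rw [mul_assoc, ← Finset.mul_sum, sum_permChar_mul_chi]
  simp

/-- The determinantal formula for the irreducible characters of the symmetric group. -/
theorem chi_eq_detChar (g : Perm (Fin μ.card)) :
    chi μ g = (detChar (fun i : Fin (μ.colLen 0) => μ.rowLen i) g : ℂ) := by
  have hre : ∀ g, chi μ g = ((chi μ g).re : ℂ) := fun g =>
    (Complex.conj_eq_iff_re.1 (conj_chi g)).symm
  have h1 := sum_chi_mul_chi (μ := μ)
  have h2 := sum_detChar_mul_chi (μ := μ)
  have h3 := sum_detChar_sq (X := Fin μ.card) (fun i : Fin (μ.colLen 0) => μ.rowLen i)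
    (fun i j hij => μ.rowLen_anti i j hij) (by rw [sum_rowLen, Fintype.card_fin])
  rw [Fintype.card_fin] at h3
  -- Expanding the square gives `n! - 2 n! + n!`; a vanishing sum of real squares vanishes termwise.
  have h4 : ∑ g : Perm (Fin μ.card),
      ((chi μ g).re - (detChar (fun i : Fin (μ.colLen 0) => μ.rowLen i) g : ℝ)) ^ 2 = 0 := by
    have h3' : ∑ g : Perm (Fin μ.card), (detChar (fun i : Fin (μ.colLen 0) => μ.rowLen i) g : ℂ) *
        (detChar (fun i : Fin (μ.colLen 0) => μ.rowLen i) g : ℂ) = μ.card.factorial := by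
      exact_mod_cast h3
    apply Complex.ofReal_injective
    push_cast
    simp_rw [← hre]
    calc _ = ∑ g, (chi μ g * chi μ g -
          2 * ((detChar (fun i : Fin (μ.colLen 0) => μ.rowLen i) g : ℂ) * chi μ g) +
          (detChar (fun i : Fin (μ.colLen 0) => μ.rowLen i) g : ℂ) *
            (detChar (fun i : Fin (μ.colLen 0) => μ.rowLen i) g : ℂ)) :=
          Finset.sum_congr rfl fun g _ => by ring
      _ = 0 := by
          rw [Finset.sum_add_distrib, Finset.sum_sub_distrib, ← Finset.mul_sum, h1, h2, h3']
          ring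
  have h5 := (Finset.sum_eq_zero_iff_of_nonneg fun g _ => sq_nonneg _).1 h4 g (Finset.mem_univ g)
  rw [hre g, sub_eq_zero.1 (pow_eq_zero_iff two_ne_zero |>.1 h5)]
  norm_cast

end JacobiTrudi

/-! ### From finite symmetric groups to `S(∞)`. -/

section FiniteToInfinite

theorem incl_apply (n : ℕ) (g : Perm (Fin n)) (x : Fin n) :
    (incl n g : Perm ℕ) x = g x :=
  Perm.viaEmbedding_apply g Fin.valEmbedding x

theorem incl_apply_of_le (n : ℕ) (g : Perm (Fin n)) {k : ℕ} (hk : n ≤ k) :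
    (incl n g : Perm ℕ) k = k := by
  refine Perm.viaEmbedding_apply_of_notMem g Fin.valEmbedding k ?_
  rintro ⟨x, rfl⟩
  exact absurd x.isLt (not_lt.mpr hk)

theorem SInf_ext {n : ℕ} {σ τ : SInf} (h₁ : ∀ x : Fin n, (σ : Perm ℕ) x = (τ : Perm ℕ) x)
    (h₂ : ∀ k, n ≤ k → (σ : Perm ℕ) k = (τ : Perm ℕ) k) : σ = τ := by
  apply Subtype.ext
  ext k
  by_cases hk : k < n
  · exact h₁ ⟨k, hk⟩
  · exact h₂ k (not_lt.1 hk)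

theorem exists_incl_eq_incl {n N : ℕ} (h : n ≤ N) (g : Perm (Fin n)) :
    ∃ g' : Perm (Fin N), incl N g' = incl n g ∧ g'.cycleType = g.cycleType := by
  classical
  refine ⟨g.viaEmbedding (Fin.castLEEmb h), ?_, ?_⟩
  · refine SInf_ext (n := N) (fun x => ?_) fun k hk => ?_
    · rw [incl_apply]
      by_cases hx : (x : ℕ) < n
      · have h1 : x = Fin.castLEEmb h ⟨x, hx⟩ := rfl
        rw [h1, Perm.viaEmbedding_apply]
        exact (incl_apply n g ⟨x, hx⟩).symm
      · rw [incl_apply_of_le n g (not_lt.1 hx), Perm.viaEmbedding_apply_of_notMem]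
        rintro ⟨y, rfl⟩
        exact hx y.isLt
    · rw [incl_apply_of_le N _ hk, incl_apply_of_le n g (h.trans hk)]
  · exact @Perm.cycleType_extendDomain _ _ _ _ _ _ _ (_) _ _

theorem exists_incl_eq (σ : SInf) : ∃ n, ∀ N, n ≤ N → ∃ g : Perm (Fin N), incl N g = σ := by
  obtain ⟨n, hn⟩ := σ.2
  have hlt : ∀ x, x < n → (σ : Perm ℕ) x < n := by
    intro x hx
    by_contra h
    have := (σ : Perm ℕ).injective (hn _ (not_lt.1 h))
    omega
  have key : ∃ g : Perm (Fin n), incl n g = σ := by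
    let f : Fin n → Fin n := fun x => ⟨(σ : Perm ℕ) x, hlt x x.2⟩
    have hf : Function.Injective f := fun x y hxy =>
      Fin.ext ((σ : Perm ℕ).injective (congrArg Fin.val hxy))
    refine ⟨Equiv.ofBijective f (Finite.injective_iff_bijective.1 hf),
      SInf_ext (n := n) (fun x => ?_) fun k hk => ?_⟩
    · rw [incl_apply]; rfl
    · rw [incl_apply_of_le n _ hk, hn k hk]
  obtain ⟨g, hg⟩ := key
  refine ⟨n, fun N hN => ?_⟩
  obtain ⟨g', hg', -⟩ := exists_incl_eq_incl hN g
  exact ⟨g', hg'.trans hg⟩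

theorem exists_map_incl_eq (l : List SInf) :
    ∃ N, ∃ l' : List (Perm (Fin N)), l'.map (incl N) = l := by
  have key : ∃ n, ∀ N, n ≤ N → ∃ l' : List (Perm (Fin N)), l'.map (incl N) = l := by
    induction l with
    | nil => exact ⟨0, fun N _ => ⟨[], rfl⟩⟩
    | cons c l ih =>
      obtain ⟨n, hn⟩ := ih
      obtain ⟨m, hm⟩ := exists_incl_eq c
      refine ⟨max n m, fun N hN => ?_⟩
      obtain ⟨l', hl'⟩ := hn N ((le_max_left _ _).trans hN)
      obtain ⟨g, hg⟩ := hm N ((le_max_right _ _).trans hN)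
      exact ⟨g :: l', by rw [List.map_cons, hl', hg]⟩
  obtain ⟨n, hn⟩ := key
  exact ⟨n, hn n le_rfl⟩

theorem disjoint_incl_iff {n : ℕ} {g h : Perm (Fin n)} :
    Perm.Disjoint (incl n g : Perm ℕ) (incl n h : Perm ℕ) ↔ Perm.Disjoint g h := by
  constructor
  · intro hd x
    have := hd x
    rwa [incl_apply, incl_apply, Fin.val_inj, Fin.val_inj] at this
  · intro hd k
    by_cases hk : k < n
    · have := hd ⟨k, hk⟩
      rw [← Fin.val_inj, ← Fin.val_inj, ← incl_apply, ← incl_apply] at this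
      exact this
    · exact Or.inl (incl_apply_of_le n g (not_lt.1 hk))

theorem isCycle_incl_iff {n : ℕ} {g : Perm (Fin n)} :
    Perm.IsCycle (incl n g : Perm ℕ) ↔ Perm.IsCycle g := by
  have hz : ∀ (i : ℤ) (x : Fin n), ((incl n g : Perm ℕ) ^ i) x = ((g ^ i) x : Fin n) := by
    intro i x
    rw [← incl_apply, map_zpow, SubgroupClass.coe_zpow]
  constructor
  · rintro ⟨k, hk, hc⟩
    have hkn : k < n := by
      by_contra h
      exact hk (incl_apply_of_le n g (not_lt.1 h))
    refine ⟨⟨k, hkn⟩, fun h => hk ?_, fun y hy => ?_⟩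
    · have := incl_apply n g ⟨k, hkn⟩
      rwa [h] at this
    · obtain ⟨i, hi⟩ := hc (y := y) (by rwa [incl_apply, Ne, Fin.val_inj])
      exact ⟨i, Fin.ext ((hz i ⟨k, hkn⟩).symm.trans hi)⟩
  · rintro ⟨x, hx, hc⟩
    refine ⟨x, by rwa [incl_apply, Ne, Fin.val_inj], fun k hk => ?_⟩
    have hkn : k < n := by
      by_contra h
      exact hk (incl_apply_of_le n g (not_lt.1 h))
    obtain ⟨i, hi⟩ := hc (y := ⟨k, hkn⟩) fun h => hk (by
      have := incl_apply n g ⟨k, hkn⟩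
      rwa [h] at this)
    exact ⟨i, (hz i x).trans (congrArg Fin.val hi)⟩

variable {φ : SInf → ℂ}

/-- Cycle types ignore fixed points, so both permutations can be moved into `S(max n m)`, where
equal cycle type means conjugate. -/
theorem IsCentral.eq_of_cycleType_eq (hφ : IsCentral φ) {n m : ℕ} {g : Perm (Fin n)}
    {h : Perm (Fin m)} (hgh : g.cycleType = h.cycleType) : φ (incl n g) = φ (incl m h) := by
  obtain ⟨g', hg', hgc⟩ := exists_incl_eq_incl (le_max_left n m) g
  obtain ⟨h', hh', hhc⟩ := exists_incl_eq_incl (le_max_right n m) h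
  obtain ⟨k, hk⟩ := isConj_iff.1 (Perm.isConj_iff_cycleType_eq.2 (hgc.trans (hgh.trans hhc.symm)))
  rw [← hg', ← hh', ← hk, map_mul, hφ, map_mul, map_inv, inv_mul_cancel_left]

theorem multiset_map_X_prod (s : Multiset ℕ) :
    (s.map MvPolynomial.X).prod = MvPolynomial.monomial (Multiset.toFinsupp s) (1 : ℂ) := by
  induction s using Multiset.induction_on with
  | empty => simp
  | cons a s ih =>
    rw [Multiset.map_cons, Multiset.prod_cons, ih, ← Multiset.singleton_add, map_add,
      Multiset.toFinsupp_singleton, MvPolynomial.X, MvPolynomial.monomial_mul, one_mul]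

/-- A central function is the composition of the cycle monomial with a linear functional. -/
theorem IsCentral.exists_linearMap (hφ : IsCentral φ) :
    ∃ Φ : MvPolynomial ℕ ℂ →ₗ[ℂ] ℂ, ∀ (n : ℕ) (g : Perm (Fin n)),
      Φ (cycleMonomial g) = φ (incl n g) := by
  classical
  -- Monomials that are not cycle types, namely those involving `X 0` or `X 1`, get the irrelevant
  -- value `0`.
  let F : (ℕ →₀ ℕ) → ℂ := fun d =>
    if h : ∃ p : Σ n, Perm (Fin n), Multiset.toFinsupp p.2.cycleType = d then
      φ (incl h.choose.1 h.choose.2) else 0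
  refine ⟨(MvPolynomial.basisMonomials ℕ ℂ).constr ℂ F, fun n g => ?_⟩
  have h1 : cycleMonomial g =
      MvPolynomial.basisMonomials ℕ ℂ (Multiset.toFinsupp g.cycleType) := by
    rw [cycleMonomial, multiset_map_X_prod, MvPolynomial.coe_basisMonomials]
  rw [h1, Module.Basis.constr_basis]
  have h2 : ∃ p : Σ n, Perm (Fin n),
      Multiset.toFinsupp p.2.cycleType = Multiset.toFinsupp g.cycleType := ⟨⟨n, g⟩, rfl⟩
  simp only [F]
  rw [dif_pos h2]
  exact hφ.eq_of_cycleType_eq (Multiset.toFinsupp.injective h2.choose_spec)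

end FiniteToInfinite

/-! ### Fourier coefficients as values of the functional `Φ`. -/

section FourierCoefficients

variable {φ : SInf → ℂ} {Φ : MvPolynomial ℕ ℂ →ₗ[ℂ] ℂ}

/-- The Frobenius characteristic of `χ^μ` is the expanded Jacobi–Trudi determinant; each index
vector sums to `|μ|` because `w` only permutes the shifts. -/
theorem sum_detChar_smul_cycleMonomial (μ : YoungDiagram) :
    ∑ g : Perm (Fin μ.card), (detChar (fun i : Fin (μ.colLen 0) => μ.rowLen i) g : ℂ) •
      cycleMonomial g = (μ.card.factorial : ℂ) • ∑ w : Perm (Fin (μ.colLen 0)),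
        ((Perm.sign w : ℤ) : ℂ) •
          ∏ i : Fin (μ.colLen 0), cycleIndexInt ((μ.rowLen i : ℤ) - (i : ℕ) + (w i : ℕ)) := by
  simp only [detChar, Int.cast_sum, Int.cast_mul, Finset.sum_smul, mul_smul]
  rw [Finset.sum_comm, Finset.smul_sum]
  refine Finset.sum_congr rfl fun w _ => ?_
  rw [← Finset.smul_sum, sum_permChar_smul_cycleMonomial, Fintype.card_fin, smul_comm]
  have hw : ∑ i, ((w i : ℕ) : ℤ) = ∑ i : Fin (μ.colLen 0), ((i : ℕ) : ℤ) :=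
    Equiv.sum_comp w fun i => ((i : ℕ) : ℤ)
  rw [Finset.sum_add_distrib, Finset.sum_sub_distrib, hw, sub_add_cancel, Fintype.card_fin,
    ← sum_rowLen μ, Nat.cast_sum]

theorem fourierCoeff_eq_sum (hΦ : ∀ (n : ℕ) (g : Perm (Fin n)), Φ (cycleMonomial g) = φ (incl n g))
    (μ : YoungDiagram) :
    fourierCoeff φ μ = ∑ w : Perm (Fin (μ.colLen 0)), ((Perm.sign w : ℤ) : ℂ) *
      Φ (∏ i : Fin (μ.colLen 0), cycleIndexInt ((μ.rowLen i : ℤ) - (i : ℕ) + (w i : ℕ))) := by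
  have h1 : ∑ g : Perm (Fin μ.card), φ (incl μ.card g) * (starRingEnd ℂ) (chi μ g) =
      Φ (∑ g : Perm (Fin μ.card), (detChar (fun i : Fin (μ.colLen 0) => μ.rowLen i) g : ℂ) •
        cycleMonomial g) := by
    rw [map_sum]
    refine Finset.sum_congr rfl fun g _ => ?_
    rw [conj_chi, chi_eq_detChar, map_smul, hΦ, smul_eq_mul, mul_comm]
  rw [fourierCoeff, innerS, h1, sum_detChar_smul_cycleMonomial, map_smul, smul_eq_mul, ← mul_assoc,
    one_div, inv_mul_cancel₀ (by exact_mod_cast μ.card.factorial_ne_zero), one_mul, map_sum]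
  simp only [map_smul, smul_eq_mul]

theorem fourierCoeff_eq_det (hΦ : ∀ (n : ℕ) (g : Perm (Fin n)), Φ (cycleMonomial g) = φ (incl n g))
    (μ : YoungDiagram) :
    fourierCoeff φ μ = Φ (Matrix.det (Matrix.of fun i j : Fin (μ.colLen 0) =>
      cycleIndexInt ((μ.rowLen i : ℤ) - (i : ℤ) + (j : ℤ)))) := by
  rw [fourierCoeff_eq_sum hΦ, ← Matrix.det_transpose, Matrix.det_apply, map_sum]
  refine Finset.sum_congr rfl fun w _ => ?_
  simp only [Matrix.transpose_apply, Matrix.of_apply]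
  rw [Units.smul_def, map_zsmul, zsmul_eq_mul]

theorem mem_oneRow {k : ℕ} {c : ℕ × ℕ} : c ∈ oneRow k ↔ c.1 = 0 ∧ c.2 < k := by
  rw [oneRow, YoungDiagram.mem_ofRowLens]
  simp only [List.length_singleton, Nat.lt_one_iff]
  constructor
  · rintro ⟨h, h'⟩
    refine ⟨h, ?_⟩
    simpa [h] using h'
  · rintro ⟨h, h'⟩
    refine ⟨h, ?_⟩
    simpa [h] using h'

theorem rowLen_oneRow (k : ℕ) : (oneRow k).rowLen 0 = k := by
  refine eq_of_forall_lt_iff fun j => ?_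
  rw [← YoungDiagram.mem_iff_lt_rowLen, mem_oneRow]
  simp

theorem colLen_oneRow (k : ℕ) : (oneRow k).colLen 0 = if k = 0 then 0 else 1 := by
  refine eq_of_forall_lt_iff fun i => ?_
  rw [← YoungDiagram.mem_iff_lt_colLen, mem_oneRow]
  split_ifs with h
  · simp [h]
  · simp [Nat.pos_of_ne_zero h]

theorem cycleIndex_zero : cycleIndex 0 = 1 := by
  simp [cycleIndex, cycleSum, cycleMonomial]

theorem rowCoeff_eq (hΦ : ∀ (n : ℕ) (g : Perm (Fin n)), Φ (cycleMonomial g) = φ (incl n g))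
    (k : ℤ) : rowCoeff φ k = Φ (cycleIndexInt k) := by
  by_cases hk : k < 0
  · rw [rowCoeff, if_pos hk, cycleIndexInt, if_pos hk, map_zero]
  · rw [rowCoeff, if_neg hk]
    lift k to ℕ using not_lt.1 hk
    rw [Int.toNat_natCast, fourierCoeff_eq_det hΦ, cycleIndexInt_natCast]
    congr 1
    have hcol := colLen_oneRow k
    have hrow := rowLen_oneRow k
    generalize (oneRow k).colLen 0 = l at hcol
    subst hcol
    by_cases h : k = 0
    · subst h
      rw [cycleIndex_zero]
      -- For `k = 0` the diagram has no rows, and the empty determinant `1` agrees with `h 0 = 1`.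
      have key : ∀ l, l = 0 → Matrix.det (Matrix.of fun i j : Fin l =>
          cycleIndexInt (((oneRow 0).rowLen i : ℤ) - (i : ℤ) + (j : ℤ))) = 1 := by
        rintro l rfl
        exact Matrix.det_fin_zero
      exact key _ (if_pos rfl)
    · have key : ∀ l, l = 1 → Matrix.det (Matrix.of fun i j : Fin l =>
          cycleIndexInt (((oneRow k).rowLen i : ℤ) - (i : ℤ) + (j : ℤ))) = cycleIndex k := by
        rintro l rfl
        rw [Matrix.det_fin_one, Matrix.of_apply]
        simp [hrow, cycleIndexInt_natCast]
      exact key _ (if_neg h)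

end FourierCoefficients

/-! ### Multiplicativity and the determinantal identities. -/

section Multiplicativity

variable {φ : SInf → ℂ} {Φ : MvPolynomial ℕ ℂ →ₗ[ℂ] ℂ}

theorem cycleMonomial_of_isCycle {X : Type*} [Fintype X] [DecidableEq X] {c : Perm X}
    (hc : c.IsCycle) : cycleMonomial c = MvPolynomial.X c.support.card := by
  rw [cycleMonomial, hc.cycleType]
  simp

theorem cycleType_list_prod {X : Type*} [Fintype X] [DecidableEq X] {l : List (Perm X)}
    (h₁ : ∀ c ∈ l, c.IsCycle) (h₂ : l.Pairwise Perm.Disjoint) :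
    (l.prod.cycleType.map fun k => Φ (MvPolynomial.X k)).prod =
      (l.map fun c => Φ (cycleMonomial c)).prod := by
  rw [Perm.cycleType_eq l rfl h₁ h₂, Multiset.map_coe, Multiset.prod_coe, List.map_map]
  congr 1
  refine List.map_congr_left fun c hc => ?_
  rw [cycleMonomial_of_isCycle (h₁ c hc)]
  rfl

/-- Multiplicativity in terms of the linear functional on cycle monomials. -/
theorem isMultiplicative_iff
    (hΦ : ∀ (n : ℕ) (g : Perm (Fin n)), Φ (cycleMonomial g) = φ (incl n g)) :
    IsMultiplicative φ ↔ ∀ (n : ℕ) (g : Perm (Fin n)),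
      Φ (cycleMonomial g) = (g.cycleType.map fun k => Φ (MvPolynomial.X k)).prod := by
  constructor
  · intro h n g
    obtain ⟨l, hl, hcyc, hdis⟩ := (Perm.truncCycleFactors g).out
    have h1 := h (l.map (incl n)) (by
      intro c hc
      obtain ⟨d, hd, rfl⟩ := List.mem_map.1 hc
      exact isCycle_incl_iff.2 (hcyc d hd)) (by
      simp only [bind_pure_comp, List.map_eq_map, List.pairwise_map]
      exact hdis.imp fun hd => disjoint_incl_iff.2 hd)
    rw [← map_list_prod, List.map_map] at h1
    rw [← hl, cycleType_list_prod hcyc hdis, hΦ, h1]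
    congr 1
    refine List.map_congr_left fun c _ => ?_
    rw [hΦ]
    rfl
  · intro h l hcyc hdis
    obtain ⟨N, l, rfl⟩ := exists_map_incl_eq l
    have hcyc' : ∀ c ∈ l, c.IsCycle := fun c hc =>
      isCycle_incl_iff.1 (hcyc _ (List.mem_map_of_mem hc))
    have hdis' : l.Pairwise Perm.Disjoint := by
      simp only [bind_pure_comp, List.map_eq_map, List.pairwise_map] at hdis
      exact hdis.imp fun hd => disjoint_incl_iff.1 hd
    rw [← map_list_prod, ← hΦ, h, cycleType_list_prod hcyc' hdis', List.map_map]
    congr 1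
    refine List.map_congr_left fun c _ => ?_
    rw [hΦ]
    rfl

/-- The algebra homomorphism `X k ↦ Φ (X k)` takes the same values on cycle monomials as `Φ`, and it
commutes with determinants. -/
theorem IsMultiplicative.fourierCoeff_eq_det (hφ : IsCentral φ) (h : IsMultiplicative φ)
    (μ : YoungDiagram) :
    fourierCoeff φ μ = Matrix.det (Matrix.of fun i j : Fin (μ.colLen 0) =>
      rowCoeff φ ((μ.rowLen i : ℤ) - (i : ℤ) + (j : ℤ))) := by
  obtain ⟨Φ, hΦ⟩ := hφ.exists_linearMap
  let Ψ : MvPolynomial ℕ ℂ →ₐ[ℂ] ℂ := MvPolynomial.aeval fun k => Φ (MvPolynomial.X k)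
  have hΨ : ∀ (n : ℕ) (g : Perm (Fin n)), Ψ.toLinearMap (cycleMonomial g) = φ (incl n g) := by
    intro n g
    rw [← hΦ, (isMultiplicative_iff hΦ).1 h, AlgHom.toLinearMap_apply, cycleMonomial,
      map_multiset_prod, Multiset.map_map]
    simp [Ψ]
  rw [InfSym.fourierCoeff_eq_det hΨ, AlgHom.toLinearMap_apply, AlgHom.map_det]
  congr 1
  ext i j
  simp only [AlgHom.mapMatrix_apply, Matrix.map_apply, Matrix.of_apply]
  rw [rowCoeff_eq hΨ]
  rfl

/-- Every finite family of natural numbers can be sorted into the rows of a Young diagram. -/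
theorem exists_youngDiagram {K : Type*} [Fintype K] (α : K → ℕ) :
    ∃ μ : YoungDiagram, ∀ (M : Type) [CommMonoid M] (f : ℕ → M), f 0 = 1 →
      ∏ i : Fin (μ.colLen 0), f (μ.rowLen i) = ∏ k, f (α k) := by
  classical
  let s : Multiset ℕ := (Finset.univ.filter fun k => α k ≠ 0).val.map α
  have hsort : (s.sort (· ≥ ·)).SortedGE := (s.pairwise_sort (· ≥ ·)).sortedGE
  have hpos : ∀ x ∈ s.sort (· ≥ ·), 0 < x := by
    intro x hx
    rw [Multiset.mem_sort, Multiset.mem_map] at hx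
    obtain ⟨k, hk, rfl⟩ := hx
    exact Nat.pos_of_ne_zero (Finset.mem_filter.1 hk).2
  refine ⟨YoungDiagram.ofRowLens _ hsort, fun M _ f hf => ?_⟩
  have h1 := YoungDiagram.rowLens_ofRowLens_eq_self (hw := hsort) hpos
  generalize YoungDiagram.ofRowLens _ hsort = μ at h1
  calc ∏ i : Fin (μ.colLen 0), f (μ.rowLen i)
      = (μ.rowLens.map f).prod := by
        rw [YoungDiagram.rowLens, List.map_map, Fin.prod_univ_eq_prod_range (fun i => f (μ.rowLen i)),
          Finset.prod_range, ← List.prod_ofFn, List.ofFn_eq_map, ← List.map_coe_finRange_eq_range,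
          List.map_map]
        rfl
    _ = (s.map f).prod := by
        rw [h1, ← Multiset.prod_coe, ← Multiset.map_coe, Multiset.sort_eq]
    _ = ∏ k with α k ≠ 0, f (α k) := by
        rw [Multiset.map_map]
        rfl
    _ = ∏ k, f (α k) := by
        refine Finset.prod_filter_of_ne fun k _ hk h0 => hk ?_
        rw [h0, hf]

/-- The compositions in the determinantal formula have a larger sum of squares than the shape. -/
theorem sum_sq_lt_sum_sq {n : ℕ} (lam : Fin n → ℕ) (hlam : Antitone lam) (w : Perm (Fin n))
    (hw : w ≠ 1) :
    ∑ i, (lam i : ℤ) ^ 2 < ∑ i, ((lam i : ℤ) - (i : ℕ) + (w i : ℕ)) ^ 2 := by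
  let L : Fin n → ℤ := fun i => (lam i : ℤ) - (i : ℕ)
  let v : Fin n → ℤ := fun i => ((i : ℕ) : ℤ)
  have hL : StrictAnti L := fun i j hij => by
    have := hlam hij.le
    have : (i : ℕ) < j := hij
    simp only [L]
    omega
  have hv : StrictMono v := fun i j hij => by
    have : (i : ℕ) < j := hij
    simp only [v]
    omega
  have hanti : Antivary L v := fun i j hij => hL.antitone (hv.lt_iff_lt.1 hij).le
  -- Rearrangement inequality: `L` decreases and `v` increases strictly, so the pairing is minimal
  -- at `w = 1` only. The other terms of the squares do not depend on `w`.
  have hlt : ∑ i, L i * v i < ∑ i, L i * v (w i) := by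
    refine hanti.sum_mul_lt_sum_mul_comp_perm_iff.2 fun hva => hw ?_
    have hmono : StrictMono (w⁻¹ : Perm (Fin n)) := by
      refine Monotone.strictMono_of_injective (fun i j hij => ?_) (w⁻¹).injective
      rcases hij.lt_or_eq with h | rfl
      · have h1 : (v ∘ w) (w⁻¹ i) < (v ∘ w) (w⁻¹ j) := by
          simp only [Function.comp_apply]
          rw [show w (w⁻¹ i) = i from w.apply_symm_apply i,
            show w (w⁻¹ j) = j from w.apply_symm_apply j]
          exact hv h
        exact hL.le_iff_ge.1 (hva h1)
      · rfl
    have h2 : w⁻¹ = 1 := by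
      have := Subsingleton.elim (hmono.orderIsoOfSurjective _ (w⁻¹).surjective)
        (OrderIso.refl (Fin n))
      ext i
      exact congrArg Fin.val (DFunLike.congr_fun this i)
    exact inv_eq_one.1 h2
  have hsq : ∑ i, v (w i) ^ 2 = ∑ i, v i ^ 2 := Equiv.sum_comp w fun i => v i ^ 2
  calc ∑ i, (lam i : ℤ) ^ 2 = ∑ i, L i ^ 2 + 2 * ∑ i, L i * v i + ∑ i, v i ^ 2 := by
        rw [Finset.mul_sum, ← Finset.sum_add_distrib, ← Finset.sum_add_distrib]
        refine Finset.sum_congr rfl fun i _ => ?_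
        simp only [L, v]; ring
    _ < ∑ i, L i ^ 2 + 2 * ∑ i, L i * v (w i) + ∑ i, v (w i) ^ 2 := by
        rw [hsq]; linarith
    _ = _ := by
        rw [Finset.mul_sum, ← Finset.sum_add_distrib, ← Finset.sum_add_distrib]
        refine Finset.sum_congr rfl fun i _ => ?_
        simp only [L, v]; ring

theorem sum_sq_le_sq_sum {K : Type*} [Fintype K] (α : K → ℕ) :
    ∑ k, α k ^ 2 ≤ (∑ k, α k) ^ 2 := by
  rw [pow_two (∑ k, α k), Finset.sum_mul]
  refine Finset.sum_le_sum fun k _ => ?_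
  rw [pow_two]
  exact Nat.mul_le_mul_left _ (Finset.single_le_sum (fun _ _ => Nat.zero_le _) (Finset.mem_univ k))

/-- The determinantal identities force multiplicativity on products of cycle indices. -/
theorem map_prod_cycleIndex (h0 : Φ 1 = 1)
    (h : ∀ μ : YoungDiagram, ∑ w : Perm (Fin (μ.colLen 0)), ((Perm.sign w : ℤ) : ℂ) *
        Φ (∏ i : Fin (μ.colLen 0), cycleIndexInt ((μ.rowLen i : ℤ) - (i : ℕ) + (w i : ℕ))) =
      ∑ w : Perm (Fin (μ.colLen 0)), ((Perm.sign w : ℤ) : ℂ) *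
        ∏ i : Fin (μ.colLen 0), Φ (cycleIndexInt ((μ.rowLen i : ℤ) - (i : ℕ) + (w i : ℕ))))
    {l : ℕ} (α : Fin l → ℕ) :
    Φ (∏ i, cycleIndex (α i)) = ∏ i, Φ (cycleIndex (α i)) := by
  -- The defect `(∑ α)² - ∑ α²` is a natural number that drops when the sum of squares grows at
  -- fixed total. The length `l` is left free because sorting into a diagram discards zeros.
  suffices H : ∀ d, ∀ l, ∀ α : Fin l → ℕ, (∑ i, α i) ^ 2 - ∑ i, α i ^ 2 = d →
      Φ (∏ i, cycleIndex (α i)) = ∏ i, Φ (cycleIndex (α i)) from H _ l α rfl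
  intro d
  induction d using Nat.strong_induction_on with
  | _ d ih =>
    rintro l α rfl
    obtain ⟨μ, hμ⟩ := exists_youngDiagram α
    rw [← hμ _ cycleIndex cycleIndex_zero, ← hμ _ (fun k => Φ (cycleIndex k))
      (by rw [cycleIndex_zero, h0])]
    have hsum : ∑ i : Fin (μ.colLen 0), μ.rowLen i = ∑ i, α i := by
      have := hμ (Multiplicative ℕ) (fun k => Multiplicative.ofAdd k) rfl
      rwa [← ofAdd_sum, ← ofAdd_sum] at this
    have hsq : ∑ i : Fin (μ.colLen 0), μ.rowLen i ^ 2 = ∑ i, α i ^ 2 := by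
      have := hμ (Multiplicative ℕ) (fun k => Multiplicative.ofAdd (k ^ 2)) rfl
      rwa [← ofAdd_sum, ← ofAdd_sum] at this
    have key : ∀ w : Perm (Fin (μ.colLen 0)), w ≠ 1 →
        Φ (∏ i : Fin (μ.colLen 0), cycleIndexInt ((μ.rowLen i : ℤ) - (i : ℕ) + (w i : ℕ))) =
          ∏ i : Fin (μ.colLen 0),
            Φ (cycleIndexInt ((μ.rowLen i : ℤ) - (i : ℕ) + (w i : ℕ))) := by
      intro w hw
      have hw1 := sum_sq_lt_sum_sq (fun i : Fin (μ.colLen 0) => μ.rowLen i)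
        (fun i j hij => μ.rowLen_anti i j hij) w hw
      have hw2 : ∑ i : Fin (μ.colLen 0), ((μ.rowLen i : ℤ) - (i : ℕ) + (w i : ℕ)) =
          ∑ i : Fin (μ.colLen 0), (μ.rowLen i : ℤ) := by
        have hw : ∑ i, ((w i : ℕ) : ℤ) = ∑ i : Fin (μ.colLen 0), ((i : ℕ) : ℤ) :=
          Equiv.sum_comp w fun i => ((i : ℕ) : ℤ)
        rw [Finset.sum_add_distrib, Finset.sum_sub_distrib, hw, sub_add_cancel]
      by_cases hneg : ∃ i : Fin (μ.colLen 0), (μ.rowLen i : ℤ) - (i : ℕ) + (w i : ℕ) < 0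
      · obtain ⟨i, hi⟩ := hneg
        rw [Finset.prod_eq_zero (Finset.mem_univ i) (by rw [cycleIndexInt, if_pos hi]), map_zero,
          Finset.prod_eq_zero (Finset.mem_univ i) (by rw [cycleIndexInt, if_pos hi, map_zero])]
      · push Not at hneg
        choose β hβ using fun i => Int.eq_ofNat_of_zero_le (hneg i)
        simp only [hβ, cycleIndexInt_natCast] at hw1 hw2 ⊢
        have hβ1 : ∑ i, β i = ∑ i, α i := by rw [← hsum]; exact_mod_cast hw2
        have hβ2 : ∑ i, α i ^ 2 < ∑ i, β i ^ 2 := by rw [← hsq]; exact_mod_cast hw1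
        have hβ3 := sum_sq_le_sq_sum β
        refine ih _ ?_ _ β rfl
        rw [hβ1] at hβ3 ⊢
        omega
    -- By induction the two expansions agree in every term with `w ≠ 1`; cancelling these leaves the
    -- diagonal terms, which are the claim.
    have h1 := h μ
    rw [← Finset.add_sum_erase _ _ (Finset.mem_univ 1),
      ← Finset.add_sum_erase _ _ (Finset.mem_univ (1 : Perm (Fin (μ.colLen 0)))),
      Finset.sum_congr rfl fun w hw => by rw [key w (Finset.ne_of_mem_erase hw)]] at h1
    have h2 := add_right_cancel h1
    simpa [cycleIndexInt_natCast] using h2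

/-- `k! • h k` is the number of `k`-cycles times `X k` plus a polynomial in the `X j` with `2 ≤ j <
k`, and that number is nonzero. -/
theorem X_mem_adjoin_cycleIndex (k : ℕ) (hk : 2 ≤ k) :
    (MvPolynomial.X k : MvPolynomial ℕ ℂ) ∈
      (MvPolynomial.aeval (R := ℂ) cycleIndex : MvPolynomial ℕ ℂ →ₐ[ℂ] MvPolynomial ℕ ℂ).range := by
  set S := (MvPolynomial.aeval (R := ℂ) cycleIndex :
    MvPolynomial ℕ ℂ →ₐ[ℂ] MvPolynomial ℕ ℂ).range with hS
  induction k using Nat.strong_induction_on with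
  | _ k ih =>
    have hsum : cycleSum k ∈ S := by
      rw [cycleSum_eq]
      exact S.smul_mem ⟨MvPolynomial.X k, by simp⟩ _
    rw [cycleSum, ← Finset.sum_filter_add_sum_filter_not Finset.univ
      fun g : Perm (Fin k) => g.cycleType = {k}] at hsum
    have hrest : ∑ g ∈ Finset.univ.filter (fun g : Perm (Fin k) => ¬ g.cycleType = {k}),
        cycleMonomial g ∈ S := by
      refine S.sum_mem fun g hg => ?_
      have hg' := (Finset.mem_filter.1 hg).2
      refine Subalgebra.multiset_prod_mem _ fun x hx => ?_
      obtain ⟨j, hj, rfl⟩ := Multiset.mem_map.1 hx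
      have hj2 := Perm.two_le_of_mem_cycleType hj
      refine ih j ?_ hj2
      have hle := Perm.sum_cycleType_le g
      rw [Fintype.card_fin] at hle
      obtain ⟨t, ht⟩ := Multiset.exists_cons_of_mem hj
      rw [ht, Multiset.sum_cons] at hle
      -- A part equal to `k` leaves no room for another, as parts are at least `2` and sum to at
      -- most `k`; the cycle type would be `{k}`.
      refine lt_of_le_of_ne (by omega) fun hjk => hg' ?_
      have ht0 : t = 0 := by
        refine Multiset.eq_zero_of_forall_notMem fun a ha => ?_
        have h1 := Multiset.le_sum_of_mem ha
        have h2 := Perm.two_le_of_mem_cycleType (σ := g) (n := a)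
          (by rw [ht]; exact Multiset.mem_cons_of_mem ha)
        omega
      rw [ht, ht0, hjk]
      rfl
    have hmain := S.sub_mem hsum hrest
    rw [add_sub_cancel_right, Finset.sum_congr rfl (g := fun _ => MvPolynomial.X k),
      Finset.sum_const, ← Nat.cast_smul_eq_nsmul ℂ] at hmain
    · obtain ⟨m, rfl⟩ : ∃ m, k = m + 2 := ⟨k - 2, by omega⟩
      have hne : ((Finset.univ.filter
          (fun g : Perm (Fin (m + 2)) => g.cycleType = {m + 2})).card : ℂ) ≠ 0 := by
        rw [Nat.cast_ne_zero, Finset.card_ne_zero]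
        exact ⟨finRotate (m + 2), Finset.mem_filter.2 ⟨Finset.mem_univ _, cycleType_finRotate⟩⟩
      have := S.smul_mem hmain ((Finset.univ.filter
        (fun g : Perm (Fin (m + 2)) => g.cycleType = {m + 2})).card : ℂ)⁻¹
      rwa [inv_smul_smul₀ hne] at this
    · intro g hg
      rw [cycleMonomial, (Finset.mem_filter.1 hg).2]
      simp

/-- The hypothesis is the case of monomials, and both sides are linear in `P`. Since `P` itself is
the variable, no algebraic independence of the `h k` is needed. -/
theorem aeval_comp_eq (h : ∀ (l : ℕ) (α : Fin l → ℕ),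
      Φ (∏ i, cycleIndex (α i)) = ∏ i, Φ (cycleIndex (α i))) (P : MvPolynomial ℕ ℂ) :
    Φ (MvPolynomial.aeval cycleIndex P) = MvPolynomial.aeval (fun k => Φ (cycleIndex k)) P := by
  have h1 : ∀ s : Multiset ℕ, Φ (s.map cycleIndex).prod = (s.map fun k => Φ (cycleIndex k)).prod := by
    intro s
    obtain ⟨l, rfl⟩ := Quot.exists_rep s
    have := h l.length l.get
    rw [← List.prod_ofFn, ← List.prod_ofFn, List.ofFn_eq_map, List.ofFn_eq_map] at this
    have e : ∀ {M : Type} (f : ℕ → M), (List.finRange l.length).map (fun i => f (l.get i)) =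
        l.map f := by
      intro M f
      rw [← List.ofFn_eq_map]
      exact List.ofFn_getElem_eq_map l f
    rw [e cycleIndex, e fun k => Φ (cycleIndex k)] at this
    exact this
  have h2 : Φ ∘ₗ (MvPolynomial.aeval cycleIndex).toLinearMap =
      (MvPolynomial.aeval (fun k => Φ (cycleIndex k))).toLinearMap := by
    refine MvPolynomial.linearMap_ext fun d => LinearMap.ext_ring ?_
    have h3 := h1 (Finsupp.toMultiset d)
    have h4 : MvPolynomial.monomial d (1 : ℂ) =
        ((Finsupp.toMultiset d).map MvPolynomial.X).prod := by
      rw [multiset_map_X_prod, Finsupp.toMultiset_toFinsupp]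
    simp only [LinearMap.comp_apply, AlgHom.toLinearMap_apply, h4, map_multiset_prod,
      Multiset.map_map, Function.comp_apply, MvPolynomial.aeval_X]
    exact h3
  exact LinearMap.congr_fun h2 P

theorem isMultiplicative_of_fourierCoeff (hφ : IsCentral φ)
    (h : ∀ μ : YoungDiagram, fourierCoeff φ μ =
      Matrix.det (Matrix.of fun i j : Fin (μ.colLen 0) =>
        rowCoeff φ ((μ.rowLen i : ℤ) - (i : ℤ) + (j : ℤ)))) :
    IsMultiplicative φ := by
  obtain ⟨Φ, hΦ⟩ := hφ.exists_linearMap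
  -- This is the identity for the empty diagram, whose determinant is empty.
  have h0 : Φ 1 = 1 := by
    have h1 := h (oneRow 0)
    have h2 := rowCoeff_eq hΦ 0
    rw [rowCoeff, if_neg (lt_irrefl 0)] at h2
    change fourierCoeff φ (oneRow 0) = _ at h2
    rw [h2, show (0 : ℤ) = ((0 : ℕ) : ℤ) from rfl, cycleIndexInt_natCast, cycleIndex_zero] at h1
    rw [h1]
    have hcol : (oneRow 0).colLen 0 = 0 := by rw [colLen_oneRow, if_pos rfl]
    have : IsEmpty (Fin ((oneRow 0).colLen 0)) := by rw [hcol]; infer_instance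
    exact Matrix.det_isEmpty
  have hprod := fun (l : ℕ) (α : Fin l → ℕ) => map_prod_cycleIndex (Φ := Φ) h0 (fun μ => by
    rw [← fourierCoeff_eq_sum hΦ, h, ← Matrix.det_transpose, Matrix.det_apply']
    refine Finset.sum_congr rfl fun w _ => ?_
    simp only [Matrix.transpose_apply, Matrix.of_apply, rowCoeff_eq hΦ]) α
  have hae := aeval_comp_eq hprod
  rw [isMultiplicative_iff hΦ]
  intro n g
  have hX : ∀ k, ∃ P : MvPolynomial ℕ ℂ, 2 ≤ k →
      MvPolynomial.aeval cycleIndex P = (MvPolynomial.X k : MvPolynomial ℕ ℂ) := by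
    intro k
    by_cases hk : 2 ≤ k
    · obtain ⟨P, hP⟩ := X_mem_adjoin_cycleIndex k hk
      exact ⟨P, fun _ => hP⟩
    · exact ⟨0, fun h => absurd h hk⟩
  choose P hP using hX
  -- Writing each `X k` as a polynomial `P k` in the cycle indices lets `hae` split `Φ` over the
  -- cycles; only `k ≥ 2` occurs in a cycle type.
  have h3 : cycleMonomial g = MvPolynomial.aeval cycleIndex (g.cycleType.map P).prod := by
    rw [map_multiset_prod, Multiset.map_map, cycleMonomial]
    congr 1
    exact Multiset.map_congr rfl fun k hk => (hP k (Perm.two_le_of_mem_cycleType hk)).symm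
  rw [h3, hae, map_multiset_prod, Multiset.map_map]
  congr 1
  refine Multiset.map_congr rfl fun k hk => ?_
  rw [Function.comp_apply, ← hae, hP k (Perm.two_le_of_mem_cycleType hk)]

end Multiplicativity

end InfSym

end


theorem proposition4 (φ : InfSym.SInf → ℂ) (hφ : InfSym.IsCentral φ) :
    InfSym.IsMultiplicative φ ↔
      ∀ μ : YoungDiagram,
        InfSym.fourierCoeff φ μ =
          Matrix.det (Matrix.of fun i j : Fin (μ.colLen 0) =>
            InfSym.rowCoeff φ ((μ.rowLen i : ℤ) - (i : ℤ) + (j : ℤ))) :=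
  ⟨fun h => h.fourierCoeff_eq_det hφ, InfSym.isMultiplicative_of_fourierCoeff hφ⟩
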